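/- Let $G$ be a connected 3-dimensional Lie group with Lie algebra $\mathfrak g$ which is unimodular, i.e. $\det \mathrm{Ad}(g)=\pm1$ for all $g\in G$, and fix a basis $X_1,X_2,X_3$ of $\mathfrak g$. Let $P\to M$ be a smooth principal $G$-bundle over a 3-manifold $M$, with right action $R_g$ of $g\in G$ and infinitesimal vector fields $A^*$, $A\in\mathfrak g$. All objects are of class $C^\infty$. An $SU(3)$-structure on $P$ is a pair $(\omega,\psi)$ of a 2-form and a 3-form which at each point is carried by some linear isomorphism $T_uP\cong\mathbb C^3$ to $\omega_0=\sum_k dx^k\wedge dy^k$ and $\psi_0=\mathrm{Im}(dz^1\wedge dz^2\wedge dz^3)$; the 3-form corresponding to $\mathrm{Re}(dz^1\wedge dz^2\wedge dz^3)$ is denoted $\psi^{\#}$. It is $G$-invariant special Lagrangian fibered (sLag) if $\omega$ and $\psi$ are invariant under the right action and restrict to zero on every fiber. Call it positively oriented (with respect to the basis) if $\psi^{\#}(X_1^*,X_2^*,X_3^*)>0$ at every point. Consider triples $(e,a,S)$, where * $e=e^kX_k$ is a solder 1-form: a horizontal $\mathfrak g$-valued 1-form on $P$ with $R_g^*e=\mathrm{Ad}(g^{-1})e$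 and $e^1\wedge e^2\wedge e^3\neq0$ everywhere; * $a=a^kX_k$ is a connection 1-form: a $\mathfrak g$-valued 1-form on $P$ with $R_g^*a=\mathrm{Ad}(g^{-1})a$ and $a(A^*)=A$ for $A\in\mathfrak g$; * $S=(S_{ij})$ is a function on $P$ with values in the positive-definite symmetric $3\times3$ matrices such that $R_g^*S=\mathrm{Ad}(g^{-1})\,S\;{}^t\mathrm{Ad}(g^{-1})$, where $\mathrm{Ad}$ is written as a matrix in the basis $X_i$. Put $$\omega=(\det S)^{-1/2}\sum_{i,j}\tilde S_{ij}\,a^i\wedge e^j,\qquad \psi=-(\det S)\,e^1\wedge e^2\wedge e^3+\sum_k e^k\wedge\hat a^k,$$ where $\tilde S$ is the adjugate matrix of $S$ and $\hat a^k=\tfrac12\sum_{i,j}\epsilon_{kij}a^i\wedge a^j$. 1. The map $(e,a,S)\mapsto(\omega,\psi)$ is a bijection from the set of all such triples onto the set of positively oriented $G$-invariant sLag $SU(3)$-structures on $P$. 2. Without orientation condition, the map $(\varepsilon,(e,a,S))\mapsto(\varepsilon\,\omega,\psi)$ is a bijection from the set of all pairs of a locally constant function $\varepsilon:P\to\{1,-1\}$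 and such a triple onto the set of all $G$-invariant sLag $SU(3)$-structures on $P$. -/

import Mathlib

open scoped Manifold ContDiff Matrix

noncomputable section

namespace SLag

/-! ### Linear algebra -/

section Linear

variable {V : Type*} [AddCommGroup V] [Module ℝ V]

/-- The exterior product `α 0 ∧ ⋯ ∧ α (k-1)` of `k` one-forms:
`(v₀, …, v_{k-1}) ↦ det (α i (v j))`. -/
def wedge {k : ℕ} (α : Fin k → V →ₗ[ℝ] ℝ) : V [⋀^Fin k]→ₗ[ℝ] ℝ :=
  (Matrix.detRowAlternating (n := Fin k) (R := ℝ)).compLinearMap (LinearMap.pi α)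

theorem wedge_apply {k : ℕ} (α : Fin k → V →ₗ[ℝ] ℝ) (v : Fin k → V) :
    wedge α v = Matrix.det (Matrix.of fun i j => α i (v j)) := by
  rw [← Matrix.det_transpose]
  rfl

/-- The Levi-Civita symbol on three letters. -/
def levi (i j k : Fin 3) : ℝ :=
  (((j : ℕ) : ℝ) - ((i : ℕ) : ℝ)) * (((k : ℕ) : ℝ) - ((i : ℕ) : ℝ)) *
    (((k : ℕ) : ℝ) - ((j : ℕ) : ℝ)) / 2

/-- The 2-form `(det S)^{-1/2} ∑ S̃ᵢⱼ aⁱ ∧ eʲ`, where `S̃` is the adjugate matrix of `S`. -/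
def omegaOf (e a : Fin 3 → V →ₗ[ℝ] ℝ) (S : Matrix (Fin 3) (Fin 3) ℝ) :
    V [⋀^Fin 2]→ₗ[ℝ] ℝ :=
  (S.det ^ (-(1 / 2) : ℝ)) • ∑ i, ∑ j, S.adjugate i j • wedge ![a i, e j]

/-- The 3-form `-(det S) e¹ ∧ e² ∧ e³ + ∑ₖ eᵏ ∧ âᵏ`, where `âᵏ = (1/2) ∑ᵢⱼ εₖᵢⱼ aⁱ ∧ aʲ`. -/
def psiOf (e a : Fin 3 → V →ₗ[ℝ] ℝ) (S : Matrix (Fin 3) (Fin 3) ℝ) :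
    V [⋀^Fin 3]→ₗ[ℝ] ℝ :=
  -(S.det • wedge e) +
    ∑ k, (1 / 2 : ℝ) • ∑ i, ∑ j, levi k i j • wedge ![e k, a i, a j]

/-- The complex volume form `dz¹ ∧ dz² ∧ dz³` of `ℂ³`, as a real-multilinear alternating map. -/
def complexVolume : (Fin 3 → ℂ) [⋀^Fin 3]→ₗ[ℝ] ℂ :=
  { (Matrix.detRowAlternating (n := Fin 3) (R := ℂ)).toMultilinearMap.restrictScalars ℝ with
    map_eq_zero_of_eq' := fun v _ _ h hij =>
      (Matrix.detRowAlternating (n := Fin 3) (R := ℂ)).map_eq_zero_of_eq v h hij }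

/-- The real coordinate `xᵏ = Re zᵏ` on `ℂ³`. -/
def xCoord (k : Fin 3) : (Fin 3 → ℂ) →ₗ[ℝ] ℝ :=
  Complex.reLm ∘ₗ (LinearMap.proj k : (Fin 3 → ℂ) →ₗ[ℝ] ℂ)

/-- The real coordinate `yᵏ = Im zᵏ` on `ℂ³`. -/
def yCoord (k : Fin 3) : (Fin 3 → ℂ) →ₗ[ℝ] ℝ :=
  Complex.imLm ∘ₗ (LinearMap.proj k : (Fin 3 → ℂ) →ₗ[ℝ] ℂ)

/-- The standard 2-form `∑ dxᵏ ∧ dyᵏ` on `ℂ³`. -/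
def omegaStd : (Fin 3 → ℂ) [⋀^Fin 2]→ₗ[ℝ] ℝ :=
  ∑ k, wedge ![xCoord k, yCoord k]

/-- The standard 3-form `Im (dz¹ ∧ dz² ∧ dz³)` on `ℂ³`. -/
def psiStd : (Fin 3 → ℂ) [⋀^Fin 3]→ₗ[ℝ] ℝ :=
  Complex.imLm.compAlternatingMap complexVolume

/-- The standard 3-form `Re (dz¹ ∧ dz² ∧ dz³)` on `ℂ³`. -/
def psiSharpStd : (Fin 3 → ℂ) [⋀^Fin 3]→ₗ[ℝ] ℝ :=
  Complex.reLm.compAlternatingMap complexVolume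

/-- `L` is a linear identification of `V` with `ℂ³` taking the standard pair to `(om, ps)` by pullback. -/
def IsAdapted (om : V [⋀^Fin 2]→ₗ[ℝ] ℝ) (ps : V [⋀^Fin 3]→ₗ[ℝ] ℝ)
    (L : V ≃ₗ[ℝ] (Fin 3 → ℂ)) : Prop :=
  omegaStd.compLinearMap L.toLinearMap = om ∧ psiStd.compLinearMap L.toLinearMap = ps

end Linear

/-! ### Lie groups and principal bundles -/

section LieGroup

variable {G : Type*} [TopologicalSpace G] [ChartedSpace (EuclideanSpace ℝ (Fin 3)) G] [Group G]

/-- The adjoint action of `g`: the derivative at `1` of `x ↦ g x g⁻¹`, an endomorphism of the Lie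
algebra (recall that `g * 1 * g⁻¹ = 1`). -/
def Ad (g : G) : GroupLieAlgebra (𝓡 3) G →ₗ[ℝ] GroupLieAlgebra (𝓡 3) G :=
  { toFun := fun A => mfderiv (𝓡 3) (𝓡 3) (fun x : G => g * x * g⁻¹) 1 A
    map_add' := fun A A' => map_add (mfderiv (𝓡 3) (𝓡 3) (fun x : G => g * x * g⁻¹) 1) A A'
    map_smul' := fun c A => map_smul (mfderiv (𝓡 3) (𝓡 3) (fun x : G => g * x * g⁻¹) 1) c A }

variable (G) in
/-- A Lie group is unimodular if `det (Ad g) = ±1` for every `g`. -/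
def Unimodular : Prop :=
  ∀ g : G, LinearMap.det (Ad g) = 1 ∨ LinearMap.det (Ad g) = -1

end LieGroup

/-- A smooth principal `G`-bundle `proj : P → M` with right action `act`, for a 3-dimensional
group `G`, a 6-manifold `P` and a 3-manifold `M`. -/
structure PrincipalBundle (G P M : Type*)
    [TopologicalSpace G] [ChartedSpace (EuclideanSpace ℝ (Fin 3)) G] [Group G]
    [TopologicalSpace P] [ChartedSpace (EuclideanSpace ℝ (Fin 6)) P]
    [TopologicalSpace M] [ChartedSpace (EuclideanSpace ℝ (Fin 3)) M] where
  /-- the bundle projection -/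
  proj : P → M
  /-- the right action -/
  act : P → G → P
  act_one : ∀ u, act u 1 = u
  act_mul : ∀ u g h, act u (g * h) = act (act u g) h
  proj_act : ∀ u g, proj (act u g) = proj u
  contMDiff_proj : ContMDiff (𝓡 6) (𝓡 3) ∞ proj
  contMDiff_act : ContMDiff ((𝓡 6).prod (𝓡 3)) (𝓡 6) ∞ (fun p : P × G => act p.1 p.2)
  /-- around every point of `M` there is a smooth equivariant local trivialization -/
  exists_trivialization : ∀ m : M, ∃ (U : Set M) (Φ : OpenPartialHomeomorph P (M × G)),
    IsOpen U ∧ m ∈ U ∧ Φ.source = proj ⁻¹' U ∧ Φ.target = U ×ˢ Set.univ ∧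
    ContMDiffOn (𝓡 6) ((𝓡 3).prod (𝓡 3)) ∞ Φ Φ.source ∧
    ContMDiffOn ((𝓡 3).prod (𝓡 3)) (𝓡 6) ∞ Φ.symm Φ.target ∧
    (∀ u ∈ Φ.source, (Φ u).1 = proj u) ∧
    ∀ u ∈ Φ.source, ∀ g : G, Φ (act u g) = (proj u, (Φ u).2 * g)

/-! ### Differential forms on the total space -/

section Forms

variable (P : Type*) [TopologicalSpace P] [ChartedSpace (EuclideanSpace ℝ (Fin 6)) P]

/-- (Not necessarily smooth) real `k`-forms. -/
abbrev Form (k : ℕ) : Type _ := ∀ u : P, TangentSpace (𝓡 6) u [⋀^Fin k]→ₗ[ℝ] ℝ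

/-- (Not necessarily smooth) `𝔤`-valued 1-forms, `𝔤` the Lie algebra of `G`. -/
abbrev LieOneForm (G : Type*) [TopologicalSpace G] [ChartedSpace (EuclideanSpace ℝ (Fin 3)) G]
    [Group G] : Type _ :=
  ∀ u : P, TangentSpace (𝓡 6) u →ₗ[ℝ] GroupLieAlgebra (𝓡 3) G

variable {P}

variable [IsManifold (𝓡 6) ∞ P]

/-- `V` is a smooth vector field on the set `U`. -/
def SmoothField (U : Set P) (V : ∀ u : P, TangentSpace (𝓡 6) u) : Prop :=
  ContMDiffOn (𝓡 6) (𝓡 6).tangent ∞ (fun u => (⟨u, V u⟩ : TangentBundle (𝓡 6) P)) U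

/-- A `k`-form is smooth if its value on any `k` smooth vector fields defined on an open set is a
smooth function there. -/
def SmoothForm {k : ℕ} (η : Form P k) : Prop :=
  ∀ (U : Set P), IsOpen U → ∀ V : Fin k → ∀ u : P, TangentSpace (𝓡 6) u,
    (∀ i, SmoothField U (V i)) →
    ContMDiffOn (𝓡 6) 𝓘(ℝ, ℝ) ∞ (fun u => η u (fun i => V i u)) U

variable {G : Type*} [TopologicalSpace G] [ChartedSpace (EuclideanSpace ℝ (Fin 3)) G] [Group G]

/-- The real-valued components `θ¹, θ², θ³` of `θ = θⁱ Xᵢ` at the point `u`. -/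
def comp (X : Module.Basis (Fin 3) ℝ (GroupLieAlgebra (𝓡 3) G)) (θ : LieOneForm P G) (u : P)
    (i : Fin 3) : TangentSpace (𝓡 6) u →ₗ[ℝ] ℝ :=
  X.coord i ∘ₗ θ u

/-- A `𝔤`-valued 1-form is smooth if its real-valued components are, i.e. if its value on any smooth
vector field defined on an open set, followed by any linear functional, is a smooth function. -/
def SmoothLieOneForm (θ : LieOneForm P G) : Prop :=
  ∀ l : GroupLieAlgebra (𝓡 3) G →ₗ[ℝ] ℝ,
    ∀ (U : Set P), IsOpen U → ∀ V : ∀ u : P, TangentSpace (𝓡 6) u, SmoothField U V →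
      ContMDiffOn (𝓡 6) 𝓘(ℝ, ℝ) ∞ (fun u => l (θ u (V u))) U

end Forms

namespace PrincipalBundle

variable {G P M : Type*}
  [TopologicalSpace G] [ChartedSpace (EuclideanSpace ℝ (Fin 3)) G] [Group G]
  [TopologicalSpace P] [ChartedSpace (EuclideanSpace ℝ (Fin 6)) P] [IsManifold (𝓡 6) ∞ P]
  [TopologicalSpace M] [ChartedSpace (EuclideanSpace ℝ (Fin 3)) M]
  (B : PrincipalBundle G P M)

/-- The differential of the right translation `R_g : u ↦ u · g` at `u`. -/
def dR (g : G) (u : P) : TangentSpace (𝓡 6) u →ₗ[ℝ] TangentSpace (𝓡 6) (B.act u g) :=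
  (mfderiv (𝓡 6) (𝓡 6) (fun v => B.act v g) u).toLinearMap

/-- The fundamental (infinitesimal) vector field `A*` of `A ∈ 𝔤` at `u`: the image of `A` under the
derivative at `1` of `g ↦ u · g` (recall that `u · 1 = u`). -/
def fundamental (A : GroupLieAlgebra (𝓡 3) G) (u : P) : TangentSpace (𝓡 6) u :=
  mfderiv (𝓡 3) (𝓡 6) (fun g : G => B.act u g) 1 A

/-- A tangent vector is vertical if it is tangent to the fiber, i.e. killed by the differential of
the projection. -/
def Vertical (u : P) (v : TangentSpace (𝓡 6) u) : Prop :=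
  mfderiv (𝓡 6) (𝓡 3) B.proj u v = 0

/-- Invariance of a real form under the right action. -/
def Invariant {k : ℕ} (η : Form P k) : Prop :=
  ∀ (g : G) (u : P), (η (B.act u g)).compLinearMap (B.dR g u) = η u

/-- The restriction of a real form to every fiber vanishes. -/
def VanishesOnFibers {k : ℕ} (η : Form P k) : Prop :=
  ∀ (u : P) (v : Fin k → TangentSpace (𝓡 6) u), (∀ i, B.Vertical u (v i)) → η u v = 0

/-- Equivariance `R_g^* θ = Ad(g⁻¹) θ` of a `𝔤`-valued 1-form. -/
def Equivariant (θ : LieOneForm P G) : Prop :=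
  ∀ (g : G) (u : P), θ (B.act u g) ∘ₗ B.dR g u = Ad g⁻¹ ∘ₗ θ u

/-- Solder 1-forms: smooth equivariant horizontal `𝔤`-valued 1-forms `e = eⁱ Xᵢ` with
`e¹ ∧ e² ∧ e³ ≠ 0` at every point. -/
structure IsSolder (X : Module.Basis (Fin 3) ℝ (GroupLieAlgebra (𝓡 3) G))
    (e : LieOneForm P G) : Prop where
  smooth : SmoothLieOneForm e
  equivariant : B.Equivariant e
  horizontal : ∀ (u : P) (v : TangentSpace (𝓡 6) u), B.Vertical u v → e u v = 0
  nondegenerate : ∀ u : P, wedge (comp X e u) ≠ 0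

/-- Connection 1-forms. -/
structure IsConnection (a : LieOneForm P G) : Prop where
  smooth : SmoothLieOneForm a
  equivariant : B.Equivariant a
  fundamental : ∀ (A : GroupLieAlgebra (𝓡 3) G) (u : P), a u (B.fundamental A u) = A

/-- Smooth functions with values in the positive-definite symmetric `3 × 3` matrices, equivariant
for the action `g · S = Ad(g) S Ad(g)ᵗ`, where `Ad(g)` is written as a matrix in the basis `X`. -/
structure IsEquivariantPosDef (X : Module.Basis (Fin 3) ℝ (GroupLieAlgebra (𝓡 3) G))
    (S : P → Matrix (Fin 3) (Fin 3) ℝ) : Prop where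
  smooth : ∀ i j, ContMDiff (𝓡 6) 𝓘(ℝ, ℝ) ∞ (fun u => S u i j)
  posDef : ∀ u, (S u).PosDef
  equivariant : ∀ (g : G) (u : P),
    S (B.act u g) = LinearMap.toMatrix X X (Ad g⁻¹) * S u * (LinearMap.toMatrix X X (Ad g⁻¹))ᵀ

/-- The set of triples `(e, a, S)` of a solder 1-form, a connection 1-form and an equivariant
function with values in the positive-definite symmetric matrices. -/
def triples (X : Module.Basis (Fin 3) ℝ (GroupLieAlgebra (𝓡 3) G)) :
    Set (LieOneForm P G × LieOneForm P G × (P → Matrix (Fin 3) (Fin 3) ℝ)) :=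
  {t | B.IsSolder X t.1 ∧ B.IsConnection t.2.1 ∧ B.IsEquivariantPosDef X t.2.2}

/-- `G`-invariant special Lagrangian fibered `SU(3)`-structures: pairs `(ω, ψ)` of smooth forms,
pointwise isomorphic to the standard pair on `ℂ³`, invariant under the right action, and vanishing
along the fibers. -/
structure IsSLag (om : Form P 2) (ps : Form P 3) : Prop where
  smooth_omega : SmoothForm om
  smooth_psi : SmoothForm ps
  adapted : ∀ u : P, ∃ L : TangentSpace (𝓡 6) u ≃ₗ[ℝ] (Fin 3 → ℂ), IsAdapted (om u) (ps u) L
  invariant_omega : B.Invariant om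
  invariant_psi : B.Invariant ps
  vanishes_omega : B.VanishesOnFibers om
  vanishes_psi : B.VanishesOnFibers ps

/-- The set of `G`-invariant special Lagrangian fibered `SU(3)`-structures. -/
def sLagStructures : Set (Form P 2 × Form P 3) :=
  {p | B.IsSLag p.1 p.2}

/-- The basis `X` is positively oriented for `(ω, ψ)`: the real 3-form `ψ^#` corresponding to
`Re (dz¹ ∧ dz² ∧ dz³)` is positive on the fundamental fields `X₁*, X₂*, X₃*` at every point. (The
value of `ψ^#` does not depend on the adapted `L`, since the stabilizer of the standard pair
in `GL(6, ℝ)` is `SU(3)`.) -/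
def PositivelyOriented (X : Module.Basis (Fin 3) ℝ (GroupLieAlgebra (𝓡 3) G))
    (om : Form P 2) (ps : Form P 3) : Prop :=
  ∀ u : P, ∃ L : TangentSpace (𝓡 6) u ≃ₗ[ℝ] (Fin 3 → ℂ), IsAdapted (om u) (ps u) L ∧
    0 < psiSharpStd (fun i => L (B.fundamental (X i) u))

end PrincipalBundle

section Correspondence

variable {G P : Type*}
  [TopologicalSpace G] [ChartedSpace (EuclideanSpace ℝ (Fin 3)) G] [Group G]
  [TopologicalSpace P] [ChartedSpace (EuclideanSpace ℝ (Fin 6)) P]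

/-- The pair `(ω, ψ)` attached to a triple `(e, a, S)`:
`ω = (det S)^{-1/2} S̃ᵢⱼ aⁱ ∧ eʲ` and `ψ = -(det S) e¹²³ + eᵏ ∧ âᵏ`. -/
def toSU3 (X : Module.Basis (Fin 3) ℝ (GroupLieAlgebra (𝓡 3) G))
    (t : LieOneForm P G × LieOneForm P G × (P → Matrix (Fin 3) (Fin 3) ℝ)) :
    Form P 2 × Form P 3 :=
  (fun u => omegaOf (comp X t.1 u) (comp X t.2.1 u) (t.2.2 u),
   fun u => psiOf (comp X t.1 u) (comp X t.2.1 u) (t.2.2 u))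

/-- Multiply the 2-form of a pair `(ω, ψ)` by a function with values in `{1, -1}`. -/
def signTwist (s : P → ℤˣ) (p : Form P 2 × Form P 3) : Form P 2 × Form P 3 :=
  (fun u => (((s u : ℤˣ) : ℤ) : ℝ) • p.1 u, p.2)

end Correspondence

end SLag

end

noncomputable section

set_option linter.unusedSectionVars false

/-! The content is pointwise linear algebra; invariance and smoothness then follow from uniqueness
and from explicit inverse formulas.

Fix a point, and let X₁, X₂, X₃ be the values of the fundamental fields, so that a is dual to X and
e kills X. The triple can be read off from (ω, ψ). Contracting ψ with two of the X's gives e. If W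
is a frame dual to e, then ω(Xᵢ, Wⱼ) is the matrix N = (det S)^{-1/2} adj S, and adj N = S since the
size is three. The values of a on W come from ψ, and ω then gives N a(v), hence a(v), for every v.
This is `IsCoframe.unique`.

Conversely, let L be an adapted identification with ℂ³ and let Z have columns L Xⱼ. Vanishing of ω
on the fiber makes the Gram matrix Zᴴ Z real, and vanishing of ψ makes d = det Z real; orientation
says d > 0. Writing Z⁻¹ L = a + i d⁻¹ e and S = (Zᴴ Z)⁻¹ turns the standard forms into the two
formulas (`exists_coframe`). Reading the same computation backwards, any factorization S⁻¹ = Zᴴ Z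
with det Z > 0 yields an adapted L, so a triple does define an SU(3)-structure
(`IsCoframe.exists_isAdapted`).

On the bundle, unimodularity and connectedness give det Ad = 1, which is what makes the formulas
compatible with changing (e, a, S) by Ad. Invariance of (ω, ψ) is then equivalent to equivariance of
the triple: one direction substitutes, the other applies uniqueness to the translated triple. The
inverse formulas show that a pointwise choice of (e, a, S) is automatically smooth.

For the unoriented statement, z ↦ -z̄ preserves ψ and reverses ω and ψ^#, so exactly one sign of ω
is positively oriented at each point. That sign is the sign of a continuous nonvanishing function,
hence locally constant, and it is constant on orbits because G is connected. -/

namespace SLag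

/-! ### Evaluation of the two forms and their behaviour under a change of basis of determinant one
-/

section Pointwise

variable {V : Type*} [AddCommGroup V] [Module ℝ V]

/-- The coefficient matrix `(det S)^{-1/2} S̃` of `omegaOf`. -/
def coeffMatrix (S : Matrix (Fin 3) (Fin 3) ℝ) : Matrix (Fin 3) (Fin 3) ℝ :=
  (S.det ^ (-(1 / 2) : ℝ)) • S.adjugate

theorem omegaOf_apply (e a : Fin 3 → V →ₗ[ℝ] ℝ) (S : Matrix (Fin 3) (Fin 3) ℝ) (v w : V) :
    omegaOf e a S ![v, w] =
      ∑ i, ∑ j, coeffMatrix S i j * (a i v * e j w - a i w * e j v) := by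
  simp only [omegaOf, coeffMatrix, AlternatingMap.smul_apply, Fin.sum_univ_three,
    AlternatingMap.add_apply, wedge_apply, Matrix.det_fin_two, Matrix.of_apply,
    Matrix.cons_val_zero, Matrix.cons_val_one, Matrix.smul_apply, smul_eq_mul]
  ring

/-- The value of `∑ₖ eᵏ ∧ âᵏ` on three vectors, in terms of the components of the vectors. -/
def mixedDet (e a : Fin 3 → Fin 3 → ℝ) : ℝ :=
  ∑ k, Matrix.det (Matrix.of ![e k, a (k + 1), a (k + 2)])

theorem mixedDet_eq (e a : Fin 3 → Fin 3 → ℝ) :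
    mixedDet e a =
      Matrix.det (Matrix.of ![e 0, a 1, a 2]) + Matrix.det (Matrix.of ![e 1, a 2, a 0]) +
        Matrix.det (Matrix.of ![e 2, a 0, a 1]) := by
  simp only [mixedDet, Fin.sum_univ_three]
  rfl

/-- The mixed determinant is the coefficient of t in det (a + t e), so it inherits multiplicativity
from the determinant. -/
theorem mixedDet_mul (R : Matrix (Fin 3) (Fin 3) ℝ) (e a : Fin 3 → Fin 3 → ℝ) :
    mixedDet (fun i l => ∑ j, R i j * e j l) (fun i l => ∑ j, R i j * a j l) =
      R.det * mixedDet e a := by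
  simp only [mixedDet_eq, Matrix.det_fin_three, Matrix.of_apply, Matrix.cons_val,
    Fin.sum_univ_three]
  ring

theorem psiOf_apply (e a : Fin 3 → V →ₗ[ℝ] ℝ) (S : Matrix (Fin 3) (Fin 3) ℝ) (v : Fin 3 → V) :
    psiOf e a S v = -(S.det * Matrix.det (Matrix.of fun i j => e i (v j))) +
      mixedDet (fun i j => e i (v j)) (fun i j => a i (v j)) := by
  simp only [psiOf, AlternatingMap.add_apply, AlternatingMap.neg_apply, AlternatingMap.smul_apply,
    Fin.sum_univ_three, wedge_apply, smul_eq_mul, mixedDet_eq]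
  congr 1
  simp only [levi, Matrix.det_fin_three, Matrix.of_apply, Matrix.cons_val, Fin.val_zero,
    Fin.val_one, Fin.val_two]
  push_cast
  ring

/-- For size three, adj (c A) = c² adj A and adj (adj S) = (det S) S, and the factor c = (det
S)^{-1/2} is the one for which these cancel. Thus S is recovered from the coefficients of ω. -/
theorem coeffMatrix_adjugate {S : Matrix (Fin 3) (Fin 3) ℝ} (hS : 0 < S.det) :
    (coeffMatrix S).adjugate = S := by
  rw [coeffMatrix, Matrix.adjugate_smul, Matrix.adjugate_adjugate _ (by simp), smul_smul,
    ← Real.rpow_natCast, ← Real.rpow_mul hS.le, ← Real.rpow_natCast S.det, ← Real.rpow_add hS]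
  norm_num

theorem coeffMatrix_posDef {S : Matrix (Fin 3) (Fin 3) ℝ} (hS : S.PosDef) :
    (coeffMatrix S).PosDef := by
  have hd := hS.det_pos
  have : S.adjugate = S.det • S⁻¹ := by
    rw [Matrix.inv_def, smul_smul, Ring.mul_inverse_cancel _ hd.ne'.isUnit, one_smul]
  rw [coeffMatrix, this]
  exact (hS.inv.smul hd).smul (Real.rpow_pos_of_pos hd _)

/-- The change of components of a vector-valued form under a matrix. -/
def mulForms (R : Matrix (Fin 3) (Fin 3) ℝ) (e : Fin 3 → V →ₗ[ℝ] ℝ) : Fin 3 → V →ₗ[ℝ] ℝ :=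
  fun i => ∑ j, R i j • e j

theorem mulForms_apply (R : Matrix (Fin 3) (Fin 3) ℝ) (e : Fin 3 → V →ₗ[ℝ] ℝ) (i : Fin 3)
    (v : V) : mulForms R e i v = (R *ᵥ fun j => e j v) i := by
  simp [mulForms, Matrix.mulVec, dotProduct]

theorem alternating_ext_two {f g : V [⋀^Fin 2]→ₗ[ℝ] ℝ} (h : ∀ v w, f ![v, w] = g ![v, w]) :
    f = g := by
  ext v
  have : v = ![v 0, v 1] := by ext i; fin_cases i <;> rfl
  rw [this]; exact h _ _

theorem omegaOf_apply' (e a : Fin 3 → V →ₗ[ℝ] ℝ) (S : Matrix (Fin 3) (Fin 3) ℝ) (v w : V) :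
    omegaOf e a S ![v, w] = (fun i => a i v) ⬝ᵥ (coeffMatrix S *ᵥ fun j => e j w) -
      (fun i => a i w) ⬝ᵥ (coeffMatrix S *ᵥ fun j => e j v) := by
  rw [omegaOf_apply]
  simp only [dotProduct, Matrix.mulVec, Fin.sum_univ_three]
  ring

/-- The adjugate reverses products and inverts R when det R = 1. This is where unimodularity enters
the formula for ω. -/
theorem coeffMatrix_conj {R S : Matrix (Fin 3) (Fin 3) ℝ} (hR : R.det = 1) :
    Rᵀ * coeffMatrix (R * S * Rᵀ) * R = coeffMatrix S := by
  have h1 : Rᵀ * (Rᵀ).adjugate = 1 := by simp [Matrix.mul_adjugate, hR]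
  have h2 : R.adjugate * R = 1 := by simp [Matrix.adjugate_mul, hR]
  simp only [coeffMatrix, Matrix.det_mul, Matrix.det_transpose, hR, one_mul, mul_one,
    Matrix.adjugate_mul_distrib, Matrix.mul_smul, Matrix.smul_mul]
  congr 1
  calc Rᵀ * ((Rᵀ).adjugate * (S.adjugate * R.adjugate)) * R
      = (Rᵀ * (Rᵀ).adjugate) * S.adjugate * (R.adjugate * R) := by simp only [Matrix.mul_assoc]
    _ = _ := by rw [h1, h2, one_mul, mul_one]

theorem omegaOf_mulForms (e a : Fin 3 → V →ₗ[ℝ] ℝ) {R S : Matrix (Fin 3) (Fin 3) ℝ}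
    (hR : R.det = 1) :
    omegaOf (mulForms R e) (mulForms R a) (R * S * Rᵀ) = omegaOf e a S := by
  refine alternating_ext_two fun v w => ?_
  have key (x y : Fin 3 → ℝ) : (R *ᵥ x) ⬝ᵥ (coeffMatrix (R * S * Rᵀ) *ᵥ (R *ᵥ y)) =
      x ⬝ᵥ (coeffMatrix S *ᵥ y) := by
    rw [← coeffMatrix_conj (S := S) hR, Matrix.mulVec_mulVec, ← Matrix.vecMul_transpose,
      ← Matrix.dotProduct_mulVec, Matrix.mulVec_mulVec, Matrix.mul_assoc, Matrix.mul_assoc]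
  rw [omegaOf_apply', omegaOf_apply']
  simp only [mulForms_apply]
  rw [key, key]

theorem psiOf_mulForms (e a : Fin 3 → V →ₗ[ℝ] ℝ) {R S : Matrix (Fin 3) (Fin 3) ℝ}
    (hR : R.det = 1) :
    psiOf (mulForms R e) (mulForms R a) (R * S * Rᵀ) = psiOf e a S := by
  ext v
  rw [psiOf_apply, psiOf_apply]
  simp only [Matrix.det_mul, Matrix.det_transpose, hR, one_mul, mul_one]
  congr 1
  · congr 2
    have : Matrix.of (fun i j => mulForms R e i (v j)) =
        R * Matrix.of (fun i j => e i (v j)) := by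
      ext i j; simp [mulForms_apply, Matrix.mulVec, dotProduct, Matrix.mul_apply]
    rw [this, Matrix.det_mul, hR, one_mul]
  · simp only [mulForms_apply, Matrix.mulVec, dotProduct]
    rw [mixedDet_mul, hR, one_mul]

end Pointwise

/-! ### Recovering (e, a, S) from (ω, ψ) at a point -/

section Uniqueness

variable {V : Type*} [AddCommGroup V] [Module ℝ V]

/-- `a` restricts to the dual basis of `X` on the span of `X`, and `e` vanishes there. -/
structure IsCoframe (e a : Fin 3 → V →ₗ[ℝ] ℝ) (X : Fin 3 → V) : Prop where
  dual : ∀ i j, a i (X j) = (1 : Matrix (Fin 3) (Fin 3) ℝ) i j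
  horizontal : ∀ i j, e i (X j) = 0

variable {e a : Fin 3 → V →ₗ[ℝ] ℝ} {S : Matrix (Fin 3) (Fin 3) ℝ} {X W : Fin 3 → V}

/-- Two arguments killed by every eⁱ leave only the term of e ∧ a ∧ a in which both a's are paired
with them. In particular S does not appear, so ψ alone determines e. -/
theorem IsCoframe.psiOf_vertical (h : IsCoframe e a X) (k : Fin 3) (v : V) :
    psiOf e a S ![v, X (k + 1), X (k + 2)] = e k v := by
  rw [psiOf_apply]
  fin_cases k <;>
  simp [Matrix.det_fin_three, mixedDet_eq, h.dual, h.horizontal, Matrix.cons_val]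

theorem IsCoframe.omegaOf_vertical (h : IsCoframe e a X) (i : Fin 3) (v : V) :
    omegaOf e a S ![X i, v] = ∑ j, coeffMatrix S i j * e j v := by
  rw [omegaOf_apply]
  simp [h.dual, h.horizontal, Matrix.one_apply]

theorem IsCoframe.omegaOf_dual (h : IsCoframe e a X)
    (hW : ∀ i j, e i (W j) = (1 : Matrix (Fin 3) (Fin 3) ℝ) i j) (i j : Fin 3) :
    omegaOf e a S ![X i, W j] = coeffMatrix S i j := by
  simp [h.omegaOf_vertical, hW, Matrix.one_apply]

theorem IsCoframe.apply_dual_add_two (h : IsCoframe e a X)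
    (hW : ∀ i j, e i (W j) = (1 : Matrix (Fin 3) (Fin 3) ℝ) i j) (l : Fin 3) :
    a (l + 2) (W l) = -psiOf e a S ![X l, W l, W (l + 1)] := by
  rw [psiOf_apply]
  fin_cases l <;>
  simp [Matrix.det_fin_three, mixedDet_eq, h.dual, h.horizontal, Matrix.cons_val,
    hW]

theorem IsCoframe.apply_dual_add_one (h : IsCoframe e a X)
    (hW : ∀ i j, e i (W j) = (1 : Matrix (Fin 3) (Fin 3) ℝ) i j) (l : Fin 3) :
    a (l + 1) (W l) = -psiOf e a S ![X l, W (l + 2), W l] := by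
  rw [psiOf_apply]
  fin_cases l <;>
  simp [Matrix.det_fin_three, mixedDet_eq, h.dual, h.horizontal, Matrix.cons_val,
    hW]

/-- ψ on (X l, W (l+1), W (l+2)) is the sum of the two diagonal entries of a with indices l+1 and
l+2. The three pairwise sums determine each entry, whence the division by two. -/
theorem IsCoframe.apply_dual_self (h : IsCoframe e a X)
    (hW : ∀ i j, e i (W j) = (1 : Matrix (Fin 3) (Fin 3) ℝ) i j) (l : Fin 3) :
    a l (W l) = (psiOf e a S ![X (l + 2), W l, W (l + 1)] + psiOf e a S ![X (l + 1), W (l + 2), W l]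
      - psiOf e a S ![X l, W (l + 1), W (l + 2)]) / 2 := by
  simp only [psiOf_apply]
  fin_cases l <;>
  · simp [Matrix.det_fin_three, mixedDet_eq, h.dual, h.horizontal, Matrix.cons_val, hW]
    try ring

/-- The components of the 1-forms `aᵏ` on a frame dual to the `eᵏ`, in terms of `ψ`. -/
def dualCoeff (ps : V [⋀^Fin 3]→ₗ[ℝ] ℝ) (X W : Fin 3 → V) (k l : Fin 3) : ℝ :=
  if k = l then (ps ![X (l + 2), W l, W (l + 1)] + ps ![X (l + 1), W (l + 2), W l]
      - ps ![X l, W (l + 1), W (l + 2)]) / 2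
  else if k = l + 1 then -ps ![X l, W (l + 2), W l]
  else -ps ![X l, W l, W (l + 1)]

theorem IsCoframe.apply_dual (h : IsCoframe e a X)
    (hW : ∀ i j, e i (W j) = (1 : Matrix (Fin 3) (Fin 3) ℝ) i j) (k l : Fin 3) :
    a k (W l) = dualCoeff (psiOf e a S) X W k l := by
  have hk : k = l ∨ k = l + 1 ∨ k = l + 2 := by decide +revert
  have h2 : l + 2 ≠ l := by decide +revert
  have h3 : l + 2 ≠ l + 1 := by decide +revert
  rcases hk with rfl | rfl | rfl
  · simp [dualCoeff, h.apply_dual_self (S := S) hW]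
  · simp [dualCoeff, h.apply_dual_add_one (S := S) hW]
  · simp [dualCoeff, h2, h.apply_dual_add_two (S := S) hW]

theorem coeffMatrix_transpose (hS : S.PosDef) : (coeffMatrix S)ᵀ = coeffMatrix S := by
  have := (coeffMatrix_posDef hS).isHermitian
  rwa [Matrix.IsHermitian, Matrix.conjTranspose_eq_transpose_of_trivial] at this

/-- The 1-forms `aⁱ` are recovered from `(ω, ψ)` and a frame dual to the `eᵏ`. -/
theorem IsCoframe.apply_eq (h : IsCoframe e a X) (hS : S.PosDef)
    (hW : ∀ i j, e i (W j) = (1 : Matrix (Fin 3) (Fin 3) ℝ) i j) (i : Fin 3) (v : V) :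
    a i v = ∑ l, (coeffMatrix S)⁻¹ i l * (omegaOf e a S ![v, W l] +
      ∑ j, (∑ k, coeffMatrix S j k * e k v) * dualCoeff (psiOf e a S) X W j l) := by
  have hN := (coeffMatrix_posDef hS).det_pos.ne'.isUnit
  -- ω(v, W l) consists of the l-th entry of N a(v), by symmetry of N, minus a term involving only
  -- e(v) and the known values a(W l). Adding that term back isolates N a(v).
  have key (l : Fin 3) : omegaOf e a S ![v, W l] +
      ∑ j, (∑ k, coeffMatrix S j k * e k v) * dualCoeff (psiOf e a S) X W j l =
      (coeffMatrix S *ᵥ fun j => a j v) l := by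
    rw [omegaOf_apply', ← coeffMatrix_transpose hS]
    simp only [hW, h.apply_dual hW (S := S)]
    rw [coeffMatrix_transpose hS]
    have : (fun j => (1 : Matrix (Fin 3) (Fin 3) ℝ) j l) = Pi.single l 1 := by
      ext j; simp [Matrix.one_apply, Pi.single_apply]
    rw [this, Matrix.mulVec_single_one, dotProduct_comm]
    have h2 : (coeffMatrix S).col l ⬝ᵥ (fun j => a j v) =
      (coeffMatrix S *ᵥ fun j => a j v) l := by
      conv_rhs => rw [← coeffMatrix_transpose hS]
      rfl
    rw [h2]
    simp [dotProduct, Matrix.mulVec, mul_comm]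
  simp only [key]
  have : (coeffMatrix S)⁻¹ *ᵥ (coeffMatrix S *ᵥ fun j => a j v) = fun j => a j v := by
    rw [Matrix.mulVec_mulVec, Matrix.nonsing_inv_mul _ hN, Matrix.one_mulVec]
  exact (congrFun this i).symm

theorem exists_dual_frame_of_wedge_ne_zero (h : wedge e ≠ 0) :
    ∃ W : Fin 3 → V, ∀ i j, e i (W j) = (1 : Matrix (Fin 3) (Fin 3) ℝ) i j := by
  have : ∃ v, wedge e v ≠ 0 := by
    by_contra! h'
    exact h (AlternatingMap.ext h')
  obtain ⟨v, hv⟩ := this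
  rw [wedge_apply] at hv
  set E := Matrix.of fun i j => e i (v j)
  -- The matrix E of values of e on v is invertible, and its inverse corrects v to a dual frame.
  refine ⟨fun j => ∑ l, E⁻¹ l j • v l, fun i j => ?_⟩
  rw [← Matrix.mul_nonsing_inv E hv.isUnit]
  simp [Matrix.mul_apply, E, mul_comm]

theorem wedge_ne_zero_of_dual (hW : ∀ i j, e i (W j) = (1 : Matrix (Fin 3) (Fin 3) ℝ) i j) :
    wedge e ≠ 0 := by
  intro h
  have : wedge e W = 1 := by
    rw [wedge_apply]
    simp only [hW]
    exact Matrix.det_one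
  simp [h] at this

variable {e' a' : Fin 3 → V →ₗ[ℝ] ℝ} {S' : Matrix (Fin 3) (Fin 3) ℝ}

theorem IsCoframe.solder_eq (h : IsCoframe e a X) (h' : IsCoframe e' a' X)
    (hpsi : psiOf e a S = psiOf e' a' S') : e = e' := by
  ext k v
  rw [← h.psiOf_vertical (S := S), hpsi, h'.psiOf_vertical]

/-- The sign of `ω` is determined by the pair `(ω, ψ)`. -/
theorem IsCoframe.sign_eq (h : IsCoframe e a X) (h' : IsCoframe e' a' X) (he : wedge e ≠ 0)
    (hS : S.PosDef) (hS' : S'.PosDef) {s s' : ℤˣ}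
    (hom : ((s : ℤ) : ℝ) • omegaOf e a S = ((s' : ℤ) : ℝ) • omegaOf e' a' S')
    (hpsi : psiOf e a S = psiOf e' a' S') : s = s' := by
  obtain rfl := h.solder_eq h' hpsi
  obtain ⟨W, hW⟩ := exists_dual_frame_of_wedge_ne_zero he
  have h0 := DFunLike.congr_fun hom ![X 0, W 0]
  simp only [AlternatingMap.smul_apply, h.omegaOf_dual hW, h'.omegaOf_dual hW, smul_eq_mul] at h0
  -- ψ already forces the two e's to agree, so both forms can be tested on the same pair (X 0, W 0).
  -- There the untwisted values are diagonal entries of positive definite matrices, so opposite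
  -- signs are impossible.
  have p := (coeffMatrix_posDef hS).diag_pos (i := 0)
  have p' := (coeffMatrix_posDef hS').diag_pos (i := 0)
  rcases Int.units_eq_one_or s with rfl | rfl <;> rcases Int.units_eq_one_or s' with rfl | rfl <;>
  first
  | rfl
  | (exfalso; norm_num at h0; linarith)

theorem IsCoframe.unique (h : IsCoframe e a X) (h' : IsCoframe e' a' X) (he : wedge e ≠ 0)
    (hS : S.PosDef) (hS' : S'.PosDef) (hom : omegaOf e a S = omegaOf e' a' S')
    (hpsi : psiOf e a S = psiOf e' a' S') : e = e' ∧ a = a' ∧ S = S' := by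
  obtain rfl := h.solder_eq h' hpsi
  obtain ⟨W, hW⟩ := exists_dual_frame_of_wedge_ne_zero he
  have hN : coeffMatrix S = coeffMatrix S' := by
    ext i j
    rw [← h.omegaOf_dual hW, hom, h'.omegaOf_dual hW]
  have hSS : S = S' := by
    rw [← coeffMatrix_adjugate hS.det_pos, hN, coeffMatrix_adjugate hS'.det_pos]
  subst hSS
  refine ⟨rfl, ?_, rfl⟩
  ext i v
  rw [h.apply_eq hS hW, h'.apply_eq hS hW, hom, hpsi]

end Uniqueness

/-! ### Gram matrices and adapted identifications with ℂ³ -/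

section Existence

variable {V : Type*} [AddCommGroup V] [Module ℝ V]

theorem xCoord_apply (k : Fin 3) (z : Fin 3 → ℂ) : xCoord k z = (z k).re := rfl
theorem yCoord_apply (k : Fin 3) (z : Fin 3 → ℂ) : yCoord k z = (z k).im := rfl

theorem omegaStd_apply (z w : Fin 3 → ℂ) : omegaStd ![z, w] = (star z ⬝ᵥ w).im := by
  simp only [omegaStd, Fin.sum_univ_three, AlternatingMap.add_apply, wedge_apply,
    Matrix.det_fin_two, Matrix.of_apply, Matrix.cons_val_zero, Matrix.cons_val_one, xCoord_apply,
    yCoord_apply, dotProduct, Pi.star_apply, Complex.star_def, Complex.add_im, Complex.mul_im,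
    Complex.conj_re, Complex.conj_im]
  ring

theorem complexVolume_apply (z : Fin 3 → Fin 3 → ℂ) : complexVolume z = Matrix.det (Matrix.of z) :=
  rfl

theorem psiStd_apply (z : Fin 3 → Fin 3 → ℂ) : psiStd z = (Matrix.det (Matrix.of z)).im := rfl

theorem psiSharpStd_apply (z : Fin 3 → Fin 3 → ℂ) :
    psiSharpStd z = (Matrix.det (Matrix.of z)).re := rfl

/-- The complex vector with real parts `aⁱ v` and imaginary parts `d⁻¹ eⁱ v`. -/
def complexCoord (e a : Fin 3 → V →ₗ[ℝ] ℝ) (d : ℝ) (v : V) (i : Fin 3) : ℂ :=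
  ⟨a i v, d⁻¹ * e i v⟩

variable {e a : Fin 3 → V →ₗ[ℝ] ℝ} {S : Matrix (Fin 3) (Fin 3) ℝ} {d : ℝ}
  {Z : Matrix (Fin 3) (Fin 3) ℂ}

theorem det_sq_of_gram (hH : Zᴴ * Z = (S⁻¹).map (↑·)) (hd : Z.det = d) : S⁻¹.det = d ^ 2 := by
  have h := congrArg Matrix.det hH
  have h2 : ((S⁻¹).map (fun x : ℝ => (x : ℂ))).det = ((S⁻¹.det : ℝ) : ℂ) :=
    (RingHom.map_det Complex.ofRealHom S⁻¹).symm
  rw [Matrix.det_mul, Matrix.det_conjTranspose, hd, h2] at h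
  rw [Complex.star_def, Complex.conj_ofReal] at h
  rw [sq]
  exact_mod_cast h.symm

theorem det_of_gram (hH : Zᴴ * Z = (S⁻¹).map (↑·)) (hd : Z.det = d) : S.det = (d ^ 2)⁻¹ := by
  rw [← det_sq_of_gram hH hd, Matrix.det_nonsing_inv, Ring.inverse_eq_inv', inv_inv]

/-- Here det S = d⁻², so (det S)^{-1/2} = d because d > 0, while adj S = d⁻² S⁻¹. -/
theorem coeffMatrix_of_gram (hd0 : 0 < d) (hH : Zᴴ * Z = (S⁻¹).map (↑·)) (hd : Z.det = d) :
    coeffMatrix S = d⁻¹ • S⁻¹ := by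
  have hS := det_of_gram hH hd
  have : S.adjugate = S.det • S⁻¹ := by
    rw [Matrix.inv_def, smul_smul, Ring.mul_inverse_cancel, one_smul]
    rw [hS]; exact (by positivity : (d ^ 2)⁻¹ ≠ 0).isUnit
  rw [coeffMatrix, this, smul_smul, hS, Real.inv_rpow (by positivity),
    Real.rpow_neg (by positivity), ← Real.sqrt_eq_rpow, Real.sqrt_sq hd0.le, inv_inv]
  congr 1
  field_simp

/-- The standard form is Im (z* w), so it becomes the imaginary part of the real symmetric form S⁻¹
extended to the vectors a + i d⁻¹ e; only the cross terms in a and e survive. -/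
theorem omegaStd_gram (hd0 : 0 < d) (hH : Zᴴ * Z = (S⁻¹).map (↑·)) (hd : Z.det = d) (v w : V) :
    omegaStd ![Z *ᵥ complexCoord e a d v, Z *ᵥ complexCoord e a d w] = omegaOf e a S ![v, w] := by
  rw [omegaStd_apply, Matrix.star_mulVec, ← Matrix.dotProduct_mulVec, Matrix.mulVec_mulVec, hH,
    omegaOf_apply', coeffMatrix_of_gram hd0 hH hd]
  simp only [dotProduct, Matrix.mulVec, Fin.sum_univ_three, complexCoord, Matrix.map_apply,
    Pi.star_apply, Complex.star_def, Complex.add_im, Complex.mul_im, Complex.mul_re, Complex.conj_re,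
    Complex.conj_im, Complex.ofReal_re, Complex.ofReal_im, Matrix.smul_apply, smul_eq_mul,
    Complex.add_re]
  have hs (i j : Fin 3) : S⁻¹ i j = S⁻¹ j i := by
    have h := congrFun (congrFun hH i) j
    have h' := congrFun (congrFun hH j) i
    have hc : (Zᴴ * Z) j i = star ((Zᴴ * Z) i j) := by
      rw [← Matrix.conjTranspose_apply, Matrix.conjTranspose_mul, Matrix.conjTranspose_conjTranspose]
    rw [hc, h, Matrix.map_apply, Matrix.map_apply, Complex.star_def, Complex.conj_ofReal] at h'
    exact_mod_cast h'
  rw [hs 1 0, hs 2 0, hs 2 1]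
  ring

/-- Multiplication by Z scales the volume form by the real number d. In Im det (a + i d⁻¹ e) the
terms linear in e give the mixed part, and the cubic one gives -d⁻³ e¹²³; after scaling, its
coefficient is -d⁻² = -det S. -/
theorem psiStd_gram (hd0 : 0 < d) (hH : Zᴴ * Z = (S⁻¹).map (↑·)) (hd : Z.det = d) (v : Fin 3 → V) :
    psiStd (fun i => Z *ᵥ complexCoord e a d (v i)) = psiOf e a S v := by
  have : Matrix.of (fun i => Z *ᵥ complexCoord e a d (v i)) =
      Matrix.of (fun i => complexCoord e a d (v i)) * Zᵀ := by
    ext i j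
    simp [Matrix.mul_apply, Matrix.mulVec, dotProduct, mul_comm]
  rw [psiStd_apply, this, Matrix.det_mul, Matrix.det_transpose, hd, psiOf_apply, det_of_gram hH hd,
    Complex.im_mul_ofReal]
  simp only [Matrix.det_fin_three, mixedDet_eq, Matrix.of_apply, Matrix.cons_val, complexCoord,
    Complex.add_im, Complex.sub_im, Complex.mul_im, Complex.mul_re]
  field_simp
  ring

/-- The real-linear map `v ↦ Z (a v + i d⁻¹ e v)`. -/
def gramMap (e a : Fin 3 → V →ₗ[ℝ] ℝ) (d : ℝ) (Z : Matrix (Fin 3) (Fin 3) ℂ) :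
    V →ₗ[ℝ] (Fin 3 → ℂ) where
  toFun v := Z *ᵥ complexCoord e a d v
  map_add' v w := by
    rw [← Matrix.mulVec_add]
    congr 1
    ext i
    apply Complex.ext <;> simp [complexCoord, mul_add]
  map_smul' c v := by
    rw [← Matrix.mulVec_smul]
    congr 1
    ext i
    apply Complex.ext <;> simp [complexCoord, mul_left_comm]

theorem gramMap_apply (v : V) : gramMap e a d Z v = Z *ᵥ complexCoord e a d v := rfl

theorem compLinearMap_two {V' : Type*} [AddCommGroup V'] [Module ℝ V']
    (η : V' [⋀^Fin 2]→ₗ[ℝ] ℝ) (f : V →ₗ[ℝ] V') (v w : V) :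
    η.compLinearMap f ![v, w] = η ![f v, f w] := by
  rw [AlternatingMap.compLinearMap_apply]
  congr 1
  ext i : 1
  fin_cases i <;> rfl

theorem isAdapted_of_gram (hd0 : 0 < d) (hH : Zᴴ * Z = (S⁻¹).map (↑·)) (hd : Z.det = d)
    (L : V ≃ₗ[ℝ] (Fin 3 → ℂ)) (hL : ∀ v, L v = Z *ᵥ complexCoord e a d v) :
    IsAdapted (omegaOf e a S) (psiOf e a S) L := by
  constructor
  · refine alternating_ext_two fun v w => ?_
    rw [← omegaStd_gram hd0 hH hd, ← hL, ← hL, compLinearMap_two]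
    rfl
  · ext v
    rw [← psiStd_gram hd0 hH hd, AlternatingMap.compLinearMap_apply]
    congr 1
    ext i : 1
    exact hL (v i)

theorem IsCoframe.complexCoord_eq {X : Fin 3 → V} (h : IsCoframe e a X) (d : ℝ) (j : Fin 3) :
    complexCoord e a d (X j) = Pi.single j 1 := by
  ext i
  simp only [complexCoord, h.dual, h.horizontal, mul_zero, Pi.single_apply, Matrix.one_apply]
  split_ifs <;> rfl

-- A real factor of S⁻¹ suffices. In odd dimension, replacing it by its negative makes the
-- determinant positive without changing the Gram matrix.
open scoped MatrixOrder in
theorem exists_gram (hS : S.PosDef) :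
    ∃ (Z : Matrix (Fin 3) (Fin 3) ℂ) (d : ℝ), 0 < d ∧ Zᴴ * Z = (S⁻¹).map (↑·) ∧ Z.det = d := by
  obtain ⟨A, hA⟩ := CStarAlgebra.nonneg_iff_eq_star_mul_self.mp hS.inv.posSemidef.nonneg
  rw [Matrix.star_eq_conjTranspose] at hA
  have hdet : A.det ≠ 0 := by
    intro h0
    have := hS.inv.det_pos
    rw [hA, Matrix.det_mul, h0, mul_zero] at this
    exact this.false
  obtain ⟨B, hB, hB0⟩ : ∃ B : Matrix (Fin 3) (Fin 3) ℝ, S⁻¹ = Bᴴ * B ∧ 0 < B.det := by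
    rcases hdet.lt_or_gt with h | h
    · refine ⟨-A, by simp [hA], ?_⟩
      rw [Matrix.det_neg, Fintype.card_fin]
      linarith
    · exact ⟨A, hA, h⟩
  refine ⟨B.map (↑·), B.det, hB0, ?_, (RingHom.map_det Complex.ofRealHom B).symm⟩
  rw [hB]
  ext i j
  simp [Matrix.mul_apply]

/-- The identification is v ↦ Z (a v + i d⁻¹ e v). It sends X j to the j-th column of Z, so ψ^# on X
is Re det Z = d > 0. -/
theorem IsCoframe.exists_isAdapted {X : Fin 3 → V} (h : IsCoframe e a X) (hS : S.PosDef)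
    (hV : Module.finrank ℝ V = 6) (hinj : ∀ v, (∀ i, e i v = 0) → (∀ i, a i v = 0) → v = 0) :
    ∃ L : V ≃ₗ[ℝ] (Fin 3 → ℂ), IsAdapted (omegaOf e a S) (psiOf e a S) L ∧
      0 < psiSharpStd (fun i => L (X i)) := by
  obtain ⟨Z, d, hd0, hH, hd⟩ := exists_gram hS
  have : FiniteDimensional ℝ V := .of_finrank_pos (by omega)
  have hZ : IsUnit Z.det := by rw [hd]; exact (by exact_mod_cast hd0.ne' : (d : ℂ) ≠ 0).isUnit
  have hi : Function.Injective (gramMap e a d Z) := by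
    rw [injective_iff_map_eq_zero]
    intro v hv
    rw [gramMap_apply] at hv
    have h0 : complexCoord e a d v = 0 := by
      rw [← Matrix.one_mulVec (complexCoord e a d v), ← Matrix.nonsing_inv_mul _ hZ,
        ← Matrix.mulVec_mulVec, hv, Matrix.mulVec_zero]
    refine hinj v (fun i => ?_) fun i => congrArg Complex.re (congrFun h0 i)
    have := congrArg Complex.im (congrFun h0 i)
    simpa [complexCoord, hd0.ne'] using this
  have hr : Module.finrank ℝ V = Module.finrank ℝ (Fin 3 → ℂ) := by
    rw [hV, Module.finrank_pi_fintype]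
    simp [Complex.finrank_real_complex]
  refine ⟨LinearMap.linearEquivOfInjective _ hi hr, isAdapted_of_gram hd0 hH hd _ fun v => rfl, ?_⟩
  rw [psiSharpStd_apply]
  have : (Matrix.of fun i => (LinearMap.linearEquivOfInjective _ hi hr) (X i)) = Zᵀ := by
    ext i j
    rw [Matrix.of_apply, LinearMap.linearEquivOfInjective_apply, gramMap_apply, h.complexCoord_eq,
      Matrix.mulVec_single_one]
    rfl
  rw [this, Matrix.det_transpose, hd]
  exact hd0

/-- The Gram matrix of a Lagrangian frame is real. -/
theorem gram_real {L : V ≃ₗ[ℝ] (Fin 3 → ℂ)} {X : Fin 3 → V}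
    (hom : ∀ i j, omegaStd.compLinearMap L.toLinearMap ![X i, X j] = 0)
    (hZ : Z = (Matrix.of fun i => L (X i))ᵀ) :
    Zᴴ * Z = ((Zᴴ * Z).map Complex.re).map (fun x : ℝ => (x : ℂ)) := by
  ext i j
  apply Complex.ext
  · simp
  · have := hom i j
    rw [compLinearMap_two, LinearEquiv.coe_coe, omegaStd_apply] at this
    simpa [Matrix.mul_apply, dotProduct, hZ] using this

open scoped ComplexOrder in
/-- A positively oriented adapted identification gives a coframe realizing the two forms. -/
theorem exists_coframe {om : V [⋀^Fin 2]→ₗ[ℝ] ℝ} {ps : V [⋀^Fin 3]→ₗ[ℝ] ℝ}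
    {L : V ≃ₗ[ℝ] (Fin 3 → ℂ)} (hL : IsAdapted om ps L) {X : Fin 3 → V}
    (hom : ∀ i j, om ![X i, X j] = 0) (hps : ps X = 0) (hX : 0 < psiSharpStd (fun i => L (X i))) :
    ∃ (e a : Fin 3 → V →ₗ[ℝ] ℝ) (S : Matrix (Fin 3) (Fin 3) ℝ), IsCoframe e a X ∧ wedge e ≠ 0 ∧
      S.PosDef ∧ omegaOf e a S = om ∧ psiOf e a S = ps := by
  obtain ⟨rfl, rfl⟩ := hL
  set Z : Matrix (Fin 3) (Fin 3) ℂ := (Matrix.of fun i => L (X i))ᵀ with hZdef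
  set d : ℝ := Z.det.re with hddef
  have hd0 : 0 < d := by rwa [hddef, hZdef, Matrix.det_transpose]
  have hd : Z.det = d := by
    apply Complex.ext
    · simp [hddef]
    · rw [hZdef, Matrix.det_transpose]; exact hps
  have hZ : IsUnit Z.det := by rw [hd]; exact (by exact_mod_cast hd0.ne' : (d : ℂ) ≠ 0).isUnit
  set H : Matrix (Fin 3) (Fin 3) ℝ := (Zᴴ * Z).map Complex.re with hHdef
  have hH : Zᴴ * Z = H.map (fun x : ℝ => (x : ℂ)) := gram_real hom hZdef
  have hHpos : H.PosDef := by
    have hc : ((H.map (fun x : ℝ => (x : ℂ)))).PosDef := by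
      rw [← hH]
      exact Matrix.PosDef.conjTranspose_mul_self _
        (Matrix.mulVec_injective_of_isUnit ((Matrix.isUnit_iff_isUnit_det _).2 hZ))
    refine Matrix.PosDef.of_dotProduct_mulVec_pos ?_ fun x hx => ?_
    · ext i j
      have := congrArg Complex.re (congrFun (congrFun hc.isHermitian.eq i) j)
      simpa using this
    · have := hc.dotProduct_mulVec_pos (x := fun i => (x i : ℂ)) (by
        intro h; apply hx; ext i; simpa using congrFun h i)
      have h3 := (Complex.pos_iff.1 this).1
      simpa [dotProduct, Matrix.mulVec] using h3
  have hHu : IsUnit H.det := hHpos.det_pos.ne'.isUnit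
  -- The matrix S will be H⁻¹, so that its inverse is the Gram matrix of L X.
  have hH' : Zᴴ * Z = (H⁻¹⁻¹).map (↑·) := by
    rw [Matrix.nonsing_inv_nonsing_inv _ hHu, hH]
  let w : V →ₗ[ℝ] (Fin 3 → ℂ) := (Z⁻¹.mulVecLin.restrictScalars ℝ) ∘ₗ L.toLinearMap
  have hw (v : V) : w v = Z⁻¹ *ᵥ L v := rfl
  let a : Fin 3 → V →ₗ[ℝ] ℝ := fun i => xCoord i ∘ₗ w
  let e : Fin 3 → V →ₗ[ℝ] ℝ := fun i => d • (yCoord i ∘ₗ w)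
  have hc (v : V) : complexCoord e a d v = w v := by
    ext i
    apply Complex.ext
    · rfl
    · change d⁻¹ * (d * (w v i).im) = _
      rw [inv_mul_cancel_left₀ hd0.ne']
  have hLv (v : V) : L v = Z *ᵥ complexCoord e a d v := by
    rw [hc, hw, Matrix.mulVec_mulVec, Matrix.mul_nonsing_inv _ hZ, Matrix.one_mulVec]
  have hwX (j : Fin 3) : w (X j) = Pi.single j 1 := by
    have : L (X j) = Z *ᵥ Pi.single j 1 := by
      rw [Matrix.mulVec_single_one]; rfl
    rw [hw, this, Matrix.mulVec_mulVec, Matrix.nonsing_inv_mul _ hZ, Matrix.one_mulVec]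
  -- Since e = d Im (Z⁻¹ L), the vectors with Z⁻¹ L equal to i d⁻¹ times a standard basis vector
  -- form a dual frame.
  have hW : ∀ i j, e i (L.symm (Z *ᵥ Pi.single j ⟨0, d⁻¹⟩)) =
      (1 : Matrix (Fin 3) (Fin 3) ℝ) i j := by
    intro i j
    change d * (w (L.symm (Z *ᵥ Pi.single j ⟨0, d⁻¹⟩)) i).im = _
    rw [hw, L.apply_symm_apply, Matrix.mulVec_mulVec, Matrix.nonsing_inv_mul _ hZ,
      Matrix.one_mulVec, Matrix.one_apply, Pi.single_apply]
    split_ifs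
    · exact mul_inv_cancel₀ hd0.ne'
    · simp
  obtain ⟨h1, h2⟩ := isAdapted_of_gram hd0 hH' hd L hLv
  refine ⟨e, a, H⁻¹, ⟨fun i j => ?_, fun i j => ?_⟩, wedge_ne_zero_of_dual hW, hHpos.inv,
    h1.symm, h2.symm⟩
  · change (w (X j) i).re = _
    rw [hwX, Matrix.one_apply, Pi.single_apply]
    split_ifs <;> rfl
  · change d * (w (X j) i).im = _
    rw [hwX, Pi.single_apply]
    split_ifs <;> simp

/-- The map `z ↦ -z̄` of `ℂ³`, reversing `ω` and `ψ^#` and preserving `ψ`. -/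
def negConj : (Fin 3 → ℂ) ≃ₗ[ℝ] (Fin 3 → ℂ) :=
  (LinearEquiv.piCongrRight fun _ => Complex.conjAe.toLinearEquiv).trans (LinearEquiv.neg ℝ)

theorem negConj_apply (z : Fin 3 → ℂ) (i : Fin 3) :
    negConj z i = -(starRingEnd ℂ) (z i) := rfl

theorem complexVolume_negConj (z : Fin 3 → Fin 3 → ℂ) :
    complexVolume (fun i => negConj (z i)) = -(starRingEnd ℂ) (complexVolume z) := by
  simp only [complexVolume_apply, Matrix.det_fin_three, Matrix.of_apply, negConj_apply, map_add,
    map_sub, map_mul]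
  ring

theorem IsAdapted.negConj {om : V [⋀^Fin 2]→ₗ[ℝ] ℝ} {ps : V [⋀^Fin 3]→ₗ[ℝ] ℝ}
    {L : V ≃ₗ[ℝ] (Fin 3 → ℂ)} (hL : IsAdapted om ps L) : IsAdapted (-om) ps (L.trans negConj) := by
  obtain ⟨rfl, rfl⟩ := hL
  constructor
  · refine alternating_ext_two fun v w => ?_
    rw [AlternatingMap.neg_apply, compLinearMap_two, compLinearMap_two, omegaStd_apply,
      omegaStd_apply]
    simp [dotProduct, negConj_apply, Fin.sum_univ_three]
    ring
  · ext v
    change (complexVolume (fun i => SLag.negConj (L (v i)))).im = _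
    rw [complexVolume_negConj]
    simp
    rfl

theorem psiSharpStd_negConj (z : Fin 3 → Fin 3 → ℂ) :
    psiSharpStd (fun i => negConj (z i)) = -psiSharpStd z := by
  change (complexVolume (fun i => SLag.negConj (z i))).re = _
  rw [complexVolume_negConj]
  simp
  rfl

open scoped ComplexOrder in
/-- Up to the sign of `ω`, an adapted pair vanishing on a 3-dimensional space is positively
oriented. -/
theorem exists_sign_isAdapted {om : V [⋀^Fin 2]→ₗ[ℝ] ℝ} {ps : V [⋀^Fin 3]→ₗ[ℝ] ℝ}
    {L : V ≃ₗ[ℝ] (Fin 3 → ℂ)} (hL : IsAdapted om ps L) {X : Fin 3 → V}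
    (hX : LinearIndependent ℝ X)
    (hom : ∀ i j, om ![X i, X j] = 0) (hps : ps X = 0) :
    ∃ (s : ℤˣ) (L' : V ≃ₗ[ℝ] (Fin 3 → ℂ)), IsAdapted (((s : ℤ) : ℝ) • om) ps L' ∧
      0 < psiSharpStd (fun i => L' (X i)) := by
  -- If Re det Z vanished, then det Z = 0, since its imaginary part is the value of ψ. The Gram
  -- matrix being real, the real and imaginary parts of a kernel vector of Z are real kernel vectors
  -- of it, which contradicts the real independence of X.
  have hne : psiSharpStd (fun i => L (X i)) ≠ 0 := by
    intro h0
    set Z : Matrix (Fin 3) (Fin 3) ℂ := (Matrix.of fun i => L (X i))ᵀ with hZ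
    have hdet : Z.det = 0 := by
      rw [hZ, Matrix.det_transpose]
      exact Complex.ext h0 (by rw [← hL.2] at hps; exact hps)
    have hH := gram_real (fun i j => by rw [hL.1]; exact hom i j) hZ
    have hreal (x : Fin 3 → ℝ) (hx : (Zᴴ * Z).map Complex.re *ᵥ x = 0) : x = 0 := by
      have h1 : (Zᴴ * Z) *ᵥ (fun i => (x i : ℂ)) = 0 := by
        rw [hH]
        ext i
        have := congrFun hx i
        simp only [Matrix.mulVec, dotProduct, Matrix.map_apply, Pi.zero_apply] at this ⊢
        exact_mod_cast this
      rw [Matrix.conjTranspose_mul_self_mulVec_eq_zero] at h1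
      have h2 : L (∑ i, x i • X i) = 0 := by
        rw [← h1, map_sum]
        ext k
        simp [Matrix.mulVec, dotProduct, hZ, mul_comm]
      rw [LinearEquiv.map_eq_zero_iff] at h2
      ext i
      exact Fintype.linearIndependent_iff.1 hX x h2 i
    obtain ⟨c, hc0, hc⟩ := Matrix.exists_mulVec_eq_zero_iff.2 hdet
    rw [← Matrix.conjTranspose_mul_self_mulVec_eq_zero, hH] at hc
    apply hc0
    have hre := hreal (fun i => (c i).re) (by
      ext i
      have := congrArg Complex.re (congrFun hc i)
      simpa [Matrix.mulVec, dotProduct] using this)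
    have him := hreal (fun i => (c i).im) (by
      ext i
      have := congrArg Complex.im (congrFun hc i)
      simpa [Matrix.mulVec, dotProduct] using this)
    ext i
    exact Complex.ext (congrFun hre i) (congrFun him i)
  rcases hne.lt_or_gt with h | h
  · refine ⟨-1, L.trans negConj, ?_, ?_⟩
    · have h1 : (((-1 : ℤˣ) : ℤ) : ℝ) • om = -om := by ext v; simp
      rw [h1]
      exact hL.negConj
    have := psiSharpStd_negConj (fun i => L (X i))
    change 0 < psiSharpStd (fun i => negConj (L (X i)))
    rw [this]; linarith
  · exact ⟨1, L, by simpa using hL, h⟩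

end Existence

/-! ### The adjoint representation has determinant one -/

section Adjoint

/-- The derivative at equal points, as a map of model spaces. -/
theorem mfderiv_congr_pt {E E' H H' M M' : Type*} [NormedAddCommGroup E] [NormedSpace ℝ E]
    [NormedAddCommGroup E'] [NormedSpace ℝ E'] [TopologicalSpace H] [TopologicalSpace H']
    [TopologicalSpace M] [TopologicalSpace M'] [ChartedSpace H M] [ChartedSpace H' M']
    (I : ModelWithCorners ℝ E H) (I' : ModelWithCorners ℝ E' H') (f : M → M') {x y : M}
    (h : x = y) (v : E) : (mfderiv I I' f x v : E') = mfderiv I I' f y v := by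
  subst h; rfl

theorem totalSpace_congr_pt {n : ℕ} {M : Type*} [TopologicalSpace M]
    [ChartedSpace (EuclideanSpace ℝ (Fin n)) M] {x y : M} (h : x = y)
    (v : EuclideanSpace ℝ (Fin n)) :
    (⟨x, v⟩ : TangentBundle (𝓡 n) M) = ⟨y, v⟩ := by
  subst h; rfl

/-- The partial derivative is the tangent map of F applied to the pair of the zero vector at x and
the fixed vector A, which depends smoothly on x. -/
theorem contMDiff_mfderiv_snd {k l n : ℕ} {M₁ M₂ N : Type*} [TopologicalSpace M₁]
    [ChartedSpace (EuclideanSpace ℝ (Fin k)) M₁] [IsManifold (𝓡 k) ∞ M₁] [TopologicalSpace M₂]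
    [ChartedSpace (EuclideanSpace ℝ (Fin l)) M₂] [IsManifold (𝓡 l) ∞ M₂] [TopologicalSpace N]
    [ChartedSpace (EuclideanSpace ℝ (Fin n)) N] [IsManifold (𝓡 n) ∞ N] {F : M₁ × M₂ → N}
    (hF : ContMDiff ((𝓡 k).prod (𝓡 l)) (𝓡 n) ∞ F) (b : M₂) (A : TangentSpace (𝓡 l) b) :
    ContMDiff (𝓡 k) (𝓡 n).tangent ∞
      (fun x => (⟨F (x, b), mfderiv (𝓡 l) (𝓡 n) (fun y => F (x, y)) b A⟩ :
        TangentBundle (𝓡 n) N)) := by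
  have S₁ : ContMDiff (𝓡 k) ((𝓡 k).tangent.prod (𝓡 l).tangent) ∞
      (fun x : M₁ => ((⟨x, 0⟩ : TangentBundle (𝓡 k) M₁), (⟨b, A⟩ : TangentBundle (𝓡 l) M₂))) :=
    (Bundle.contMDiff_zeroSection ℝ (TangentSpace (𝓡 k) (M := M₁))).prodMk contMDiff_const
  have S₂ := contMDiff_equivTangentBundleProd_symm (I := 𝓡 k) (I' := 𝓡 l) (M := M₁) (M' := M₂)
    (n := ∞)
  have S₃ := hF.contMDiff_tangentMap (m := ∞) (by rfl)
  convert! (S₃.comp S₂).comp S₁ with x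
  simp only [Function.comp_apply, tangentMap]
  rw [mfderiv_prod_eq_add_apply (hF.mdifferentiableAt (by simp))]
  exact ((congrArg (· + _) (map_zero _)).trans (zero_add _)).symm

variable {G : Type*} [TopologicalSpace G] [ChartedSpace (EuclideanSpace ℝ (Fin 3)) G] [Group G]
  [LieGroup (𝓡 3) ∞ G]

theorem continuous_of_totalSpace_continuous {X : Type*} [TopologicalSpace X]
    {x₀ : G} {f : X → EuclideanSpace ℝ (Fin 3)}
    (hf : Continuous fun x => (⟨x₀, f x⟩ : TangentBundle (𝓡 3) G)) : Continuous f := by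
  rw [continuous_iff_continuousAt] at hf ⊢
  intro x
  have h := (FiberBundle.continuousAt_totalSpace _ _).1 (hf x)
  have h2 := h.2
  convert h2 using 2 with y
  exact (congrArg Prod.snd (FiberBundleCore.localTrivAt_apply_mk
    (tangentBundleCore (𝓡 3) G).toFiberBundleCore x₀ (f y))).symm

theorem continuous_Ad (A : GroupLieAlgebra (𝓡 3) G) :
    Continuous (fun g : G => (Ad g A : EuclideanSpace ℝ (Fin 3))) := by
  have h : ContMDiff ((𝓡 3).prod (𝓡 3)) (𝓡 3) ∞ (fun p : G × G => p.1 * p.2 * p.1⁻¹) :=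
    (contMDiff_fst.mul contMDiff_snd).mul contMDiff_fst.inv
  have h2 := (contMDiff_mfderiv_snd h 1 A).continuous
  apply continuous_of_totalSpace_continuous (x₀ := (1 : G))
  convert! h2 using 2 with g
  exact totalSpace_congr_pt (by simp) _

/-- The determinant is continuous in g and equals 1 at the identity. If it took the value -1, it
would vanish somewhere on the connected group, contrary to unimodularity. -/
theorem det_Ad_eq_one [ConnectedSpace G] (hG : Unimodular G) (g : G) :
    LinearMap.det (Ad g) = 1 := by
  have hc : Continuous fun g : G => LinearMap.det (Ad g) := by
    let b : Module.Basis (Fin 3) ℝ (GroupLieAlgebra (𝓡 3) G) :=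
      (EuclideanSpace.basisFun (Fin 3) ℝ).toBasis
    have h (g : G) : LinearMap.det (Ad g) = (LinearMap.toMatrix b b (Ad g)).det :=
      (LinearMap.det_toMatrix b (Ad g)).symm
    simp only [h]
    refine Continuous.matrix_det (continuous_matrix fun i j => ?_)
    have h2 : (fun g : G => LinearMap.toMatrix b b (Ad g) i j) =
        fun g : G => (EuclideanSpace.proj i : EuclideanSpace ℝ (Fin 3) →L[ℝ] ℝ) (Ad g (b j)) := by
      ext g
      rw [LinearMap.toMatrix_apply]
      rfl
    rw [h2]
    exact (EuclideanSpace.proj i : EuclideanSpace ℝ (Fin 3) →L[ℝ] ℝ).continuous.comp (continuous_Ad (b j))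
  have h1 : LinearMap.det (Ad (1 : G)) = 1 := by
    have : Ad (1 : G) = LinearMap.id := by
      ext A : 1
      have h0 : (fun x : G => 1 * x * 1⁻¹) = id := by ext x; simp
      change (mfderiv (𝓡 3) (𝓡 3) (fun x : G => 1 * x * 1⁻¹) 1 A : EuclideanSpace ℝ (Fin 3)) = A
      rw [h0, mfderiv_id]
      rfl
    rw [this, LinearMap.det_id]
  rcases hG g with h | h
  · exact h
  · exfalso
    obtain ⟨x, hx⟩ := mem_range_of_exists_le_of_exists_ge hc ⟨g, (by rw [h]; norm_num :
      LinearMap.det (Ad g) ≤ 0)⟩ ⟨1, (by rw [h1]; norm_num)⟩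
    change LinearMap.det (Ad x) = 0 at hx
    rcases hG x with h | h <;> rw [h] at hx <;> norm_num at hx

end Adjoint

/-! ### Fundamental fields and vertical vectors -/

namespace PrincipalBundle

variable {G P M : Type*}
  [TopologicalSpace G] [ChartedSpace (EuclideanSpace ℝ (Fin 3)) G] [Group G]
  [LieGroup (𝓡 3) ∞ G]
  [TopologicalSpace P] [ChartedSpace (EuclideanSpace ℝ (Fin 6)) P] [IsManifold (𝓡 6) ∞ P]
  [TopologicalSpace M] [ChartedSpace (EuclideanSpace ℝ (Fin 3)) M] [IsManifold (𝓡 3) ∞ M]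
  (B : PrincipalBundle G P M)

theorem contMDiff_act_right (u : P) : ContMDiff (𝓡 3) (𝓡 6) ∞ (B.act u) :=
  B.contMDiff_act.comp (contMDiff_const.prodMk contMDiff_id)

theorem contMDiff_act_left (g : G) : ContMDiff (𝓡 6) (𝓡 6) ∞ (fun u => B.act u g) :=
  B.contMDiff_act.comp (contMDiff_id.prodMk contMDiff_const)

theorem fundamental_smooth (A : GroupLieAlgebra (𝓡 3) G) :
    ContMDiff (𝓡 6) (𝓡 6).tangent ∞
      (fun u => (⟨u, B.fundamental A u⟩ : TangentBundle (𝓡 6) P)) := by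
  convert! contMDiff_mfderiv_snd B.contMDiff_act 1 A using 2 with u
  exact (totalSpace_congr_pt (B.act_one u) _).symm

/-- Differentiate u x g = (u g)(g⁻¹ x g) in x at the identity. -/
theorem dR_fundamental (g : G) (u : P) (A : GroupLieAlgebra (𝓡 3) G) :
    B.dR g u (B.fundamental A u) = B.fundamental (Ad g⁻¹ A) (B.act u g) := by
  have d1 := (B.contMDiff_act_left g).mdifferentiable (by simp)
  have d2 := (B.contMDiff_act_right u).mdifferentiable (by simp)
  have d3 := (B.contMDiff_act_right (B.act u g)).mdifferentiable (by simp)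
  have d4 : MDifferentiable (𝓡 3) (𝓡 3) (fun x : G => g⁻¹ * x * g⁻¹⁻¹) :=
    ((contMDiff_const.mul contMDiff_id).mul contMDiff_const : ContMDiff (𝓡 3) (𝓡 3) ∞
      (fun x : G => g⁻¹ * x * g⁻¹⁻¹)).mdifferentiable (by simp)
  have hL := mfderiv_comp_apply (1 : G) (d1 (B.act u 1)) (d2 1) A
  have hR := mfderiv_comp_apply (1 : G) (d3 (g⁻¹ * 1 * g⁻¹⁻¹)) (d4 1) A
  have hfun : (fun v => B.act v g) ∘ B.act u =
      B.act (B.act u g) ∘ fun x : G => g⁻¹ * x * g⁻¹⁻¹ := by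
    ext x
    simp only [Function.comp_apply, ← B.act_mul]
    group
  have hL' := mfderiv_congr_pt (𝓡 6) (𝓡 6) (fun v => B.act v g) (B.act_one u)
    (mfderiv (𝓡 3) (𝓡 6) (B.act u) 1 A)
  have hR' := mfderiv_congr_pt (𝓡 3) (𝓡 6) (B.act (B.act u g))
    (by simp : g⁻¹ * 1 * g⁻¹⁻¹ = (1 : G))
    (mfderiv (𝓡 3) (𝓡 3) (fun x : G => g⁻¹ * x * g⁻¹⁻¹) 1 A)
  refine (hL'.symm.trans (hL.symm.trans ?_)).trans (hR.trans hR')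
  rw [hfun]

/-- The group component of a trivialization, normalized at u, is a left inverse of the orbit map.
Its derivative makes A ↦ A* injective. -/
theorem exists_retraction (u : P) : ∃ r : P → G, MDifferentiableAt (𝓡 6) (𝓡 3) r u ∧
    ∀ g, r (B.act u g) = g := by
  obtain ⟨U, Φ, hU, hm, hs, ht, hΦ, hΦs, h1, h2⟩ := B.exists_trivialization (B.proj u)
  have hu : u ∈ Φ.source := by rw [hs]; exact hm
  refine ⟨fun v => (Φ u).2⁻¹ * (Φ v).2, ?_, fun g => ?_⟩
  · have h3 := (hΦ.contMDiffAt (Φ.open_source.mem_nhds hu)).snd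
    exact (contMDiffAt_const.mul h3).mdifferentiableAt (by simp)
  · simp [h2 u hu]

theorem exists_section (u : P) : ∃ σ : M → P, MDifferentiableAt (𝓡 3) (𝓡 6) σ (B.proj u) ∧
    σ (B.proj u) = u ∧ ∀ᶠ m in nhds (B.proj u), B.proj (σ m) = m := by
  obtain ⟨U, Φ, hU, hm, hs, ht, hΦ, hΦs, h1, h2⟩ := B.exists_trivialization (B.proj u)
  have hu : u ∈ Φ.source := by rw [hs]; exact hm
  have hpt : (B.proj u, (Φ u).2) = Φ u := by rw [← h1 u hu]
  refine ⟨fun m => Φ.symm (m, (Φ u).2), ?_, ?_, ?_⟩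
  · have h3 : ContMDiffAt ((𝓡 3).prod (𝓡 3)) (𝓡 6) ∞ Φ.symm (B.proj u, (Φ u).2) := by
      apply hΦs.contMDiffAt
      rw [hpt]
      exact Φ.open_target.mem_nhds (Φ.map_source hu)
    exact (h3.comp (B.proj u) (contMDiffAt_id.prodMk contMDiffAt_const)).mdifferentiableAt (by simp)
  · simp only [hpt]
    exact Φ.left_inv hu
  · filter_upwards [hU.mem_nhds hm] with m hm'
    have hmt : (m, (Φ u).2) ∈ Φ.target := by rw [ht]; exact ⟨hm', trivial⟩
    rw [← h1 _ (Φ.map_target hmt), Φ.right_inv hmt]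

/-- The fundamental vector field map, as a linear map. -/
def fundamentalLin (u : P) : GroupLieAlgebra (𝓡 3) G →ₗ[ℝ] TangentSpace (𝓡 6) u :=
  (mfderiv (𝓡 3) (𝓡 6) (fun g : G => B.act u g) 1).toLinearMap

theorem fundamentalLin_apply (u : P) (A : GroupLieAlgebra (𝓡 3) G) :
    B.fundamentalLin u A = B.fundamental A u := rfl

theorem fundamentalLin_injective (u : P) : Function.Injective (B.fundamentalLin u) := by
  obtain ⟨r, hr, hr'⟩ := B.exists_retraction u
  have d2 := (B.contMDiff_act_right u).mdifferentiable (by simp) 1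
  have hr1 : MDifferentiableAt (𝓡 6) (𝓡 3) r (B.act u 1) := by rwa [B.act_one]
  refine Function.LeftInverse.injective (g := fun v => mfderiv (𝓡 6) (𝓡 3) r (B.act u 1) v)
    fun A => ?_
  have h := mfderiv_comp_apply (1 : G) hr1 d2 A
  have h0 : r ∘ B.act u = id := funext hr'
  rw [h0, mfderiv_id] at h
  exact h.symm

theorem vertical_fundamental (u : P) (A : GroupLieAlgebra (𝓡 3) G) :
    B.Vertical u (B.fundamental A u) := by
  have d1 := B.contMDiff_proj.mdifferentiable (by simp)
  have d2 := (B.contMDiff_act_right u).mdifferentiable (by simp) 1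
  have h := mfderiv_comp_apply (1 : G) (d1 (B.act u 1)) d2 A
  have h0 : B.proj ∘ B.act u = fun _ => B.proj u := funext (B.proj_act u)
  rw [h0, mfderiv_const] at h
  exact (mfderiv_congr_pt (𝓡 6) (𝓡 3) B.proj (B.act_one u) _).symm.trans h.symm

theorem mfderiv_proj_surjective (u : P) :
    Function.Surjective (mfderiv (𝓡 6) (𝓡 3) B.proj u) := by
  obtain ⟨σ, h1, h2, h3⟩ := B.exists_section u
  have d1 := B.contMDiff_proj.mdifferentiable (by simp)
  intro w
  refine ⟨mfderiv (𝓡 3) (𝓡 6) σ (B.proj u) w, ?_⟩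
  have h := mfderiv_comp_apply (B.proj u) (d1 (σ (B.proj u))) h1 w
  have h0 : B.proj ∘ σ =ᶠ[nhds (B.proj u)] id := h3
  rw [h0.mfderiv_eq, mfderiv_id] at h
  exact (mfderiv_congr_pt (𝓡 6) (𝓡 3) B.proj h2 _).symm.trans h.symm

/-- The vertical space has dimension 6 - 3 = 3 because the projection is a submersion, so the
injective map A ↦ A* from the Lie algebra fills it. -/
theorem exists_fundamental_of_vertical {u : P} {v : TangentSpace (𝓡 6) u} (hv : B.Vertical u v) :
    ∃ A, B.fundamental A u = v := by
  let p : EuclideanSpace ℝ (Fin 6) →ₗ[ℝ] EuclideanSpace ℝ (Fin 3) :=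
    (mfderiv (𝓡 6) (𝓡 3) B.proj u).toLinearMap
  have hp : LinearMap.range p = ⊤ := LinearMap.range_eq_top.2 (B.mfderiv_proj_surjective u)
  have hrank := LinearMap.finrank_range_add_finrank_ker p
  rw [hp, finrank_top, finrank_euclideanSpace, finrank_euclideanSpace, Fintype.card_fin,
    Fintype.card_fin] at hrank
  let f : EuclideanSpace ℝ (Fin 3) →ₗ[ℝ] LinearMap.ker p :=
    LinearMap.codRestrict _ (B.fundamentalLin u) fun A => B.vertical_fundamental u A
  have hf : Function.Injective f := fun A A' h =>
    B.fundamentalLin_injective u (congrArg Subtype.val h)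
  have hs : Function.Surjective f :=
    (LinearMap.injective_iff_surjective_of_finrank_eq_finrank (by
      rw [finrank_euclideanSpace, Fintype.card_fin]; omega)).1 hf
  obtain ⟨A, hA⟩ := hs ⟨v, hv⟩
  exact ⟨A, congrArg Subtype.val hA⟩

end PrincipalBundle

/-! ### Smoothness of the forms and of the recovered triple -/

section Smooth

variable {P : Type*} [TopologicalSpace P] [ChartedSpace (EuclideanSpace ℝ (Fin 6)) P]
  {U U' : Set P}

theorem contMDiffOn_matrix_comp {f : (Fin 3 → Fin 3 → ℝ) → ℝ} (hf : ContDiff ℝ ∞ f)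
    {A : P → Matrix (Fin 3) (Fin 3) ℝ}
    (hA : ∀ i j, ContMDiffOn (𝓡 6) 𝓘(ℝ, ℝ) ∞ (fun u => A u i j) U) :
    ContMDiffOn (𝓡 6) 𝓘(ℝ, ℝ) ∞ (fun u => f (A u)) U := by
  have h : ContMDiffOn (𝓡 6) 𝓘(ℝ, Fin 3 → Fin 3 → ℝ) ∞ (fun u i j => A u i j) U :=
    contMDiffOn_pi_space.2 fun i => contMDiffOn_pi_space.2 fun j => hA i j
  exact hf.contMDiff.comp_contMDiffOn h

theorem contDiff_det : ContDiff ℝ ∞ (fun A : Fin 3 → Fin 3 → ℝ => Matrix.det (Matrix.of A)) := by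
  simp only [Matrix.det_fin_three, Matrix.of_apply]
  fun_prop

theorem contDiff_adjugate (i j : Fin 3) :
    ContDiff ℝ ∞ (fun A : Fin 3 → Fin 3 → ℝ => (Matrix.of A).adjugate i j) := by
  simp only [Matrix.adjugate_fin_three, Matrix.of_apply]
  fin_cases i <;> fin_cases j <;> simp [Matrix.cons_val] <;> fun_prop

section

variable {A : P → Matrix (Fin 3) (Fin 3) ℝ}
  (hA : ∀ i j, ContMDiffOn (𝓡 6) 𝓘(ℝ, ℝ) ∞ (fun u => A u i j) U)
include hA

theorem contMDiffOn_matrix_det : ContMDiffOn (𝓡 6) 𝓘(ℝ, ℝ) ∞ (fun u => (A u).det) U :=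
  contMDiffOn_matrix_comp contDiff_det hA

theorem contMDiffOn_matrix_adjugate (i j : Fin 3) :
    ContMDiffOn (𝓡 6) 𝓘(ℝ, ℝ) ∞ (fun u => (A u).adjugate i j) U :=
  contMDiffOn_matrix_comp (contDiff_adjugate i j) hA

theorem contMDiffOn_matrix_inv (hdet : ∀ u ∈ U, (A u).det ≠ 0) (i j : Fin 3) :
    ContMDiffOn (𝓡 6) 𝓘(ℝ, ℝ) ∞ (fun u => (A u)⁻¹ i j) U := by
  simp only [Matrix.inv_def, Ring.inverse_eq_inv', Matrix.smul_apply, smul_eq_mul]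
  exact ((contMDiffOn_matrix_det hA).inv₀ hdet).mul (contMDiffOn_matrix_adjugate hA i j)

theorem contMDiffOn_coeffMatrix (hdet : ∀ u ∈ U, 0 < (A u).det) (i j : Fin 3) :
    ContMDiffOn (𝓡 6) 𝓘(ℝ, ℝ) ∞ (fun u => coeffMatrix (A u) i j) U := by
  simp only [coeffMatrix, Matrix.smul_apply, smul_eq_mul]
  refine ContMDiffOn.mul (fun u hu => ?_) (contMDiffOn_matrix_adjugate hA i j)
  exact (Real.contDiffAt_rpow_const_of_ne (hdet u hu).ne').comp_contMDiffWithinAt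
    (f := fun u => (A u).det) (contMDiffOn_matrix_det hA u hu)

end

variable [IsManifold (𝓡 6) ∞ P]

theorem SmoothField.mono {V : ∀ u : P, TangentSpace (𝓡 6) u} (hV : SmoothField U V)
    (h : U' ⊆ U) : SmoothField U' V :=
  ContMDiffOn.mono hV h

theorem SmoothForm.apply_two {om : Form P 2} (h : SmoothForm om) (hU : IsOpen U)
    {V W : ∀ u : P, TangentSpace (𝓡 6) u} (hV : SmoothField U V) (hW : SmoothField U W) :
    ContMDiffOn (𝓡 6) 𝓘(ℝ, ℝ) ∞ (fun u => om u ![V u, W u]) U := by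
  refine (h U hU ![V, W] fun i => ?_).congr fun u _ => ?_
  · fin_cases i <;> assumption
  · congr 1
    ext i : 1
    fin_cases i <;> rfl

theorem SmoothForm.apply_three {ps : Form P 3} (h : SmoothForm ps) (hU : IsOpen U)
    {V W Y : ∀ u : P, TangentSpace (𝓡 6) u} (hV : SmoothField U V) (hW : SmoothField U W)
    (hY : SmoothField U Y) :
    ContMDiffOn (𝓡 6) 𝓘(ℝ, ℝ) ∞ (fun u => ps u ![V u, W u, Y u]) U := by
  refine (h U hU ![V, W, Y] fun i => ?_).congr fun u _ => ?_
  · fin_cases i <;> assumption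
  · congr 1
    ext i : 1
    fin_cases i <;> rfl

/-- Every tangent vector extends to a smooth vector field on a neighbourhood. -/
theorem exists_smoothField_extending (u₀ : P) (v : TangentSpace (𝓡 6) u₀) :
    ∃ (U : Set P) (V : ∀ u : P, TangentSpace (𝓡 6) u), IsOpen U ∧ u₀ ∈ U ∧ SmoothField U V ∧
      V u₀ = v := by
  let e := trivializationAt (EuclideanSpace ℝ (Fin 6)) (TangentSpace (𝓡 6) (M := P)) u₀
  have h0 : u₀ ∈ e.baseSet := FiberBundle.mem_baseSet_trivializationAt' u₀
  refine ⟨e.baseSet, fun u => e.symm u (e ⟨u₀, v⟩).2, e.open_baseSet, h0, ?_,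
    e.symm_apply_apply_mk h0 v⟩
  -- A tangent bundle loses one derivative, harmlessly since ∞ + 1 = ∞.
  have hM : IsManifold (𝓡 6) (∞ + 1) P := ‹IsManifold (𝓡 6) ∞ P›
  have h : ContMDiffVectorBundle ∞ (EuclideanSpace ℝ (Fin 6)) (TangentSpace (𝓡 6) (M := P))
      (𝓡 6) := TangentBundle.contMDiffVectorBundle (n := ∞) (I := 𝓡 6) (M := P)
  refine (Bundle.Trivialization.contMDiffOn_section_baseSet_iff e).2 ?_
  refine (contMDiffOn_const (c := (e ⟨u₀, v⟩).2)).congr fun y hy => ?_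
  rw [e.apply_mk_symm hy]

theorem SmoothField.sum {f : Fin 3 → P → ℝ} {V : Fin 3 → ∀ u : P, TangentSpace (𝓡 6) u}
    (hf : ∀ i, ContMDiffOn (𝓡 6) 𝓘(ℝ, ℝ) ∞ (f i) U) (hV : ∀ i, SmoothField U (V i)) :
    SmoothField U (fun u => ∑ i, f i u • V i u) :=
  ContMDiffOn.sum_section (t := fun i u => f i u • V i u) fun i _ => (hf i).smul_section (hV i)

/-- A smooth coframe of three 1-forms has a smooth dual frame near every point. -/
theorem exists_local_dual_frame {θ : ∀ u : P, Fin 3 → TangentSpace (𝓡 6) u →ₗ[ℝ] ℝ}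
    (hθ : ∀ i (U : Set P), IsOpen U → ∀ V : ∀ u : P, TangentSpace (𝓡 6) u, SmoothField U V →
      ContMDiffOn (𝓡 6) 𝓘(ℝ, ℝ) ∞ (fun u => θ u i (V u)) U)
    (u₀ : P) (h0 : wedge (θ u₀) ≠ 0) :
    ∃ (U : Set P) (W : Fin 3 → ∀ u : P, TangentSpace (𝓡 6) u), IsOpen U ∧ u₀ ∈ U ∧
      (∀ i, SmoothField U (W i)) ∧
      ∀ u ∈ U, ∀ i j, θ u i (W j u) = (1 : Matrix (Fin 3) (Fin 3) ℝ) i j := by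
  obtain ⟨w, hw⟩ := exists_dual_frame_of_wedge_ne_zero h0
  choose U V hU hu hV hVw using fun j => exists_smoothField_extending u₀ (w j)
  let U₁ : Set P := ⋂ j, U j
  have hU₁ : IsOpen U₁ := isOpen_iInter_of_finite hU
  have hu₁ : u₀ ∈ U₁ := Set.mem_iInter.2 hu
  have hV₁ (j : Fin 3) : SmoothField U₁ (V j) := (hV j).mono (Set.iInter_subset _ j)
  let E : P → Matrix (Fin 3) (Fin 3) ℝ := fun u => Matrix.of fun i j => θ u i (V j u)
  have hE (i j : Fin 3) : ContMDiffOn (𝓡 6) 𝓘(ℝ, ℝ) ∞ (fun u => E u i j) U₁ :=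
    hθ i U₁ hU₁ _ (hV₁ j)
  have hdet := contMDiffOn_matrix_det hE
  -- Vectors dual at u₀ are extended arbitrarily; where the matrix of values stays invertible, its
  -- smooth inverse restores duality.
  let U₂ : Set P := U₁ ∩ (fun u => (E u).det) ⁻¹' {0}ᶜ
  have hU₂ : IsOpen U₂ := hdet.continuousOn.isOpen_inter_preimage hU₁ isOpen_compl_singleton
  have hE0 : E u₀ = 1 := by
    ext i j
    simp only [E, Matrix.of_apply, hVw, hw]
  have hinv := contMDiffOn_matrix_inv (fun i j => (hE i j).mono Set.inter_subset_left)
    (fun u (hu : u ∈ U₂) => hu.2)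
  refine ⟨U₂, fun j u => ∑ l, (E u)⁻¹ l j • V l u, hU₂, ⟨hu₁, by simp [hE0]⟩, fun j => ?_,
    fun u hu i j => ?_⟩
  · exact SmoothField.sum (fun l => hinv l j) fun l => (hV₁ l).mono Set.inter_subset_left
  · have hu' : (E u).det ≠ 0 := hu.2
    rw [← Matrix.mul_nonsing_inv (E u) hu'.isUnit]
    simp [Matrix.mul_apply, E, mul_comm]

variable {e a : ∀ u : P, Fin 3 → TangentSpace (𝓡 6) u →ₗ[ℝ] ℝ}
  {S : P → Matrix (Fin 3) (Fin 3) ℝ}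

/-- Smoothness of a family of 1-forms. -/
def SmoothOneForms (θ : ∀ u : P, Fin 3 → TangentSpace (𝓡 6) u →ₗ[ℝ] ℝ) : Prop :=
  ∀ i (U : Set P), IsOpen U → ∀ V : ∀ u : P, TangentSpace (𝓡 6) u, SmoothField U V →
      ContMDiffOn (𝓡 6) 𝓘(ℝ, ℝ) ∞ (fun u => θ u i (V u)) U

theorem smoothForm_omegaOf (he : SmoothOneForms e) (ha : SmoothOneForms a)
    (hS : ∀ i j, ContMDiff (𝓡 6) 𝓘(ℝ, ℝ) ∞ (fun u => S u i j)) (hdet : ∀ u, 0 < (S u).det) :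
    SmoothForm (fun u => omegaOf (e u) (a u) (S u)) := by
  intro U hU V hV
  have h : ∀ u ∈ U, omegaOf (e u) (a u) (S u) (fun i => V i u) =
      ∑ i, ∑ j, coeffMatrix (S u) i j *
        (a u i (V 0 u) * e u j (V 1 u) - a u i (V 1 u) * e u j (V 0 u)) := by
    intro u _
    rw [← omegaOf_apply]
    congr 1
    ext i : 1
    fin_cases i <;> rfl
  refine ContMDiffOn.congr ?_ h
  refine contMDiffOn_finsetSum fun i _ => contMDiffOn_finsetSum fun j _ => ?_
  exact (contMDiffOn_coeffMatrix (fun i j => (hS i j).contMDiffOn) (fun u _ => hdet u) i j).mul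
    (((ha i U hU _ (hV 0)).mul (he j U hU _ (hV 1))).sub
      ((ha i U hU _ (hV 1)).mul (he j U hU _ (hV 0))))

theorem smoothForm_psiOf (he : SmoothOneForms e) (ha : SmoothOneForms a)
    (hS : ∀ i j, ContMDiff (𝓡 6) 𝓘(ℝ, ℝ) ∞ (fun u => S u i j)) :
    SmoothForm (fun u => psiOf (e u) (a u) (S u)) := by
  intro U hU V hV
  simp only [psiOf_apply, mixedDet]
  refine ContMDiffOn.add (ContMDiffOn.neg (ContMDiffOn.mul ?_ ?_))
    (contMDiffOn_finsetSum fun k _ => ?_)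
  · exact contMDiffOn_matrix_det fun i j => (hS i j).contMDiffOn
  · exact contMDiffOn_matrix_det fun i j => he i U hU _ (hV j)
  · refine contMDiffOn_matrix_det fun i j => ?_
    fin_cases i
    · exact he k U hU _ (hV j)
    · exact ha (k + 1) U hU _ (hV j)
    · exact ha (k + 2) U hU _ (hV j)

section Recover

variable {om : Form P 2} {ps : Form P 3} {X : Fin 3 → ∀ u : P, TangentSpace (𝓡 6) u}
  (hom : SmoothForm om) (hps : SmoothForm ps) (hX : ∀ i, SmoothField Set.univ (X i))
  (hc : ∀ u, IsCoframe (e u) (a u) (fun i => X i u)) (hpsi : ∀ u, psiOf (e u) (a u) (S u) = ps u)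
include hps hX hc hpsi

/-- Since e is the contraction of ψ with fundamental fields, its smoothness needs no assumption on
how e, a, S were chosen. It must come first, as the local dual frames used for S and a are built
from e. -/
theorem smoothOneForms_solder : SmoothOneForms e := by
  intro i U hU V hV
  refine (hps.apply_three hU hV ((hX (i + 1)).mono (Set.subset_univ _))
    ((hX (i + 2)).mono (Set.subset_univ _))).congr fun u _ => ?_
  rw [← hpsi, (hc u).psiOf_vertical]

variable (he : ∀ u, wedge (e u) ≠ 0) (hS : ∀ u, (S u).PosDef)
  (homega : ∀ u, omegaOf (e u) (a u) (S u) = om u)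
include hom he hS homega

theorem contMDiff_coeffMatrix (i j : Fin 3) :
    ContMDiff (𝓡 6) 𝓘(ℝ, ℝ) ∞ (fun u => coeffMatrix (S u) i j) := by
  intro u₀
  obtain ⟨U, W, hU, hu, hW, hWe⟩ := exists_local_dual_frame
    (smoothOneForms_solder hps hX hc hpsi) u₀ (he u₀)
  refine ContMDiffOn.contMDiffAt (s := U) ?_ (hU.mem_nhds hu)
  refine (hom.apply_two hU ((hX i).mono (Set.subset_univ _)) (hW j)).congr fun u hu => ?_
  rw [← homega, (hc u).omegaOf_dual (hWe u hu)]

theorem contMDiff_posDef (i j : Fin 3) : ContMDiff (𝓡 6) 𝓘(ℝ, ℝ) ∞ (fun u => S u i j) := by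
  rw [← contMDiffOn_univ]
  refine (contMDiffOn_matrix_adjugate (fun i j =>
    (contMDiff_coeffMatrix hom hps hX hc hpsi he hS homega i j).contMDiffOn) i j).congr
    fun u _ => ?_
  rw [coeffMatrix_adjugate (hS u).det_pos]

theorem smoothOneForms_connection : SmoothOneForms a := by
  intro i U hU V hV u₀ hu₀
  obtain ⟨U₁, W, hU₁, hu, hW, hWe⟩ := exists_local_dual_frame
    (smoothOneForms_solder hps hX hc hpsi) u₀ (he u₀)
  have hN := contMDiff_coeffMatrix hom hps hX hc hpsi he hS homega
  have hO : IsOpen (U ∩ U₁) := hU.inter hU₁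
  have hV' := hV.mono (Set.inter_subset_left (s := U) (t := U₁))
  have hW' := fun l => (hW l).mono (Set.inter_subset_right (s := U) (t := U₁))
  have hX' := fun l => (hX l).mono (Set.subset_univ (U ∩ U₁))
  have hd (k l : Fin 3) :
      ContMDiffOn (𝓡 6) 𝓘(ℝ, ℝ) ∞ (fun u => dualCoeff (ps u) (fun i => X i u) (fun i => W i u) k l)
        (U ∩ U₁) := by
    have h3 := fun p q r => hps.apply_three hO (hX' p) (hW' q) (hW' r)
    unfold dualCoeff
    split_ifs
    · exact (((h3 _ _ _).add (h3 _ _ _)).sub (h3 _ _ _)).div_const 2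
    · exact (h3 _ _ _).neg
    · exact (h3 _ _ _).neg
  have key : ContMDiffOn (𝓡 6) 𝓘(ℝ, ℝ) ∞ (fun u => a u i (V u)) (U ∩ U₁) := by
    refine ContMDiffOn.congr ?_ fun u hu => (hc u).apply_eq (hS u) (hWe u hu.2) i (V u)
    simp only [homega, hpsi]
    refine contMDiffOn_finsetSum fun l _ => ContMDiffOn.mul
      (contMDiffOn_matrix_inv (fun i j => (hN i j).contMDiffOn)
        (fun u _ => (coeffMatrix_posDef (hS u)).det_pos.ne') i l)
      ((hom.apply_two hO hV' (hW' l)).add (contMDiffOn_finsetSum fun j _ => ContMDiffOn.mul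
        (contMDiffOn_finsetSum fun k _ => (hN j k).contMDiffOn.mul
          (smoothOneForms_solder hps hX hc hpsi k _ hO V hV')) (hd j l)))
  exact (key.contMDiffAt (hO.mem_nhds ⟨hu₀, hu⟩)).contMDiffWithinAt

end Recover

end Smooth

/-! ### Pullback, vanishing and nondegeneracy -/

section Linear

variable {V V' : Type*} [AddCommGroup V] [Module ℝ V] [AddCommGroup V'] [Module ℝ V']

theorem omegaOf_compLinearMap (e a : Fin 3 → V →ₗ[ℝ] ℝ) (S : Matrix (Fin 3) (Fin 3) ℝ)
    (f : V' →ₗ[ℝ] V) :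
    (omegaOf e a S).compLinearMap f = omegaOf (fun i => e i ∘ₗ f) (fun i => a i ∘ₗ f) S := by
  refine alternating_ext_two fun v w => ?_
  rw [compLinearMap_two, omegaOf_apply, omegaOf_apply]
  rfl

theorem psiOf_compLinearMap (e a : Fin 3 → V →ₗ[ℝ] ℝ) (S : Matrix (Fin 3) (Fin 3) ℝ)
    (f : V' →ₗ[ℝ] V) :
    (psiOf e a S).compLinearMap f = psiOf (fun i => e i ∘ₗ f) (fun i => a i ∘ₗ f) S := by
  ext v
  rw [AlternatingMap.compLinearMap_apply, psiOf_apply, psiOf_apply]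
  rfl

variable {e a : Fin 3 → V →ₗ[ℝ] ℝ} {S : Matrix (Fin 3) (Fin 3) ℝ}

theorem omegaOf_eq_zero {v : Fin 2 → V} (h : ∀ i j, e i (v j) = 0) : omegaOf e a S v = 0 := by
  have hv : v = ![v 0, v 1] := by ext i : 1; fin_cases i <;> rfl
  rw [hv, omegaOf_apply]
  simp [h]

theorem psiOf_eq_zero {v : Fin 3 → V} (h : ∀ i j, e i (v j) = 0) : psiOf e a S v = 0 := by
  rw [psiOf_apply]
  simp [h, mixedDet_eq, Matrix.det_fin_three]

/-- The frames W and X show that (e, a) maps onto ℝ³ × ℝ³; in dimension six it is therefore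
injective. -/
theorem IsCoframe.eq_zero {X : Fin 3 → V} (h : IsCoframe e a X) (he : wedge e ≠ 0)
    (hV : Module.finrank ℝ V = 6) {v : V} (h1 : ∀ i, e i v = 0) (h2 : ∀ i, a i v = 0) : v = 0 := by
  obtain ⟨W, hW⟩ := exists_dual_frame_of_wedge_ne_zero he
  have : FiniteDimensional ℝ V := .of_finrank_pos (by omega)
  let f : V →ₗ[ℝ] (Fin 3 → ℝ) × (Fin 3 → ℝ) := (LinearMap.pi e).prod (LinearMap.pi a)
  have hf : Function.Surjective f := by
    rintro ⟨d, c⟩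
    refine ⟨∑ j, d j • W j + ∑ i, (c i - ∑ j, d j * a i (W j)) • X i, ?_⟩
    apply Prod.ext
    · ext k
      simp [f, h.horizontal, hW, Matrix.one_apply]
    · ext k
      simp [f, h.dual, Matrix.one_apply]
  have hi : Function.Injective f :=
    (LinearMap.injective_iff_surjective_of_finrank_eq_finrank (by simp [hV])).2 hf
  apply hi
  rw [map_zero]
  exact Prod.ext (funext h1) (funext h2)

theorem mulForms_mulForms (R Q : Matrix (Fin 3) (Fin 3) ℝ) (θ : Fin 3 → V →ₗ[ℝ] ℝ) :
    mulForms R (mulForms Q θ) = mulForms (R * Q) θ := by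
  ext i v
  simp only [mulForms_apply]
  rw [← Matrix.mulVec_mulVec]

theorem mulForms_one (θ : Fin 3 → V →ₗ[ℝ] ℝ) : mulForms 1 θ = θ := by
  ext i v
  simp [mulForms_apply]

end Linear

/-! ### Lie-algebra-valued forms and their components -/

section Components

variable {G P : Type*}
  [TopologicalSpace G] [ChartedSpace (EuclideanSpace ℝ (Fin 3)) G] [Group G]
  [TopologicalSpace P] [ChartedSpace (EuclideanSpace ℝ (Fin 6)) P] [IsManifold (𝓡 6) ∞ P]
  (X : Module.Basis (Fin 3) ℝ (GroupLieAlgebra (𝓡 3) G))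

theorem comp_apply (θ : LieOneForm P G) (u : P) (i : Fin 3) (v : TangentSpace (𝓡 6) u) :
    comp X θ u i v = X.coord i (θ u v) := rfl

theorem comp_injective {θ θ' : LieOneForm P G} (h : ∀ u, comp X θ u = comp X θ' u) : θ = θ' := by
  funext u
  ext v : 1
  refine X.ext_elem fun i => ?_
  exact LinearMap.congr_fun (congrFun (h u) i) v

/-- The `𝔤`-valued 1-form with given components. -/
def ofComp (θ : ∀ u : P, Fin 3 → TangentSpace (𝓡 6) u →ₗ[ℝ] ℝ) : LieOneForm P G :=
  fun u => ∑ i, (θ u i).smulRight (X i)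

theorem comp_ofComp (θ : ∀ u : P, Fin 3 → TangentSpace (𝓡 6) u →ₗ[ℝ] ℝ) (u : P) :
    comp X (ofComp X θ) u = θ u := by
  ext i v
  rw [comp_apply, ofComp, LinearMap.sum_apply, map_sum]
  simp [Finsupp.single_apply]

theorem smoothLieOneForm_iff (θ : LieOneForm P G) :
    SmoothLieOneForm θ ↔ SmoothOneForms (comp X θ) := by
  constructor
  · intro h i U hU V hV
    exact h (X.coord i) U hU V hV
  · intro h l U hU V hV
    have h1 : ∀ u ∈ U, l (θ u (V u)) = ∑ i, comp X θ u i (V u) * l (X i) := by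
      intro u _
      conv_lhs => rw [← X.sum_repr (θ u (V u)), map_sum]
      simp only [map_smul, smul_eq_mul]
      rfl
    exact (contMDiffOn_finsetSum fun i _ => (h i U hU V hV).mul contMDiffOn_const).congr h1

end Components

/-! ### The two bijections on the bundle -/

namespace PrincipalBundle

variable {G P M : Type*}
  [TopologicalSpace G] [ChartedSpace (EuclideanSpace ℝ (Fin 3)) G] [Group G]
  [LieGroup (𝓡 3) ∞ G]
  [TopologicalSpace P] [ChartedSpace (EuclideanSpace ℝ (Fin 6)) P] [IsManifold (𝓡 6) ∞ P]
  [TopologicalSpace M] [ChartedSpace (EuclideanSpace ℝ (Fin 3)) M] [IsManifold (𝓡 3) ∞ M]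
  {B : PrincipalBundle G P M} {X : Module.Basis (Fin 3) ℝ (GroupLieAlgebra (𝓡 3) G)}

theorem finrank_tangentSpace (u : P) : Module.finrank ℝ (TangentSpace (𝓡 6) u) = 6 := by
  change Module.finrank ℝ (EuclideanSpace ℝ (Fin 6)) = 6
  simp

theorem isCoframe {e a : LieOneForm P G} (he : B.IsSolder X e) (ha : B.IsConnection a) (u : P) :
    IsCoframe (comp X e u) (comp X a u) (fun i => B.fundamental (X i) u) := by
  refine ⟨fun i j => ?_, fun i j => ?_⟩
  · rw [comp_apply, ha.fundamental, Module.Basis.coord_apply, X.repr_self, Finsupp.single_apply,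
      Matrix.one_apply]
    simp [eq_comm]
  · rw [comp_apply, he.horizontal _ _ (B.vertical_fundamental u _), map_zero]

theorem fundamental_linearIndependent (B : PrincipalBundle G P M)
    (X : Module.Basis (Fin 3) ℝ (GroupLieAlgebra (𝓡 3) G)) (u : P) :
    LinearIndependent ℝ (fun i => B.fundamental (X i) u) :=
  X.linearIndependent.map' (B.fundamentalLin u)
    (LinearMap.ker_eq_bot.2 (B.fundamentalLin_injective u))

/-- The matrix of the adjoint action of `g⁻¹`. -/
def adMatrix (X : Module.Basis (Fin 3) ℝ (GroupLieAlgebra (𝓡 3) G)) (g : G) :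
    Matrix (Fin 3) (Fin 3) ℝ :=
  LinearMap.toMatrix X X (Ad g⁻¹)

theorem det_adMatrix [ConnectedSpace G] (hG : Unimodular G) (g : G) : (adMatrix X g).det = 1 := by
  rw [adMatrix, LinearMap.det_toMatrix, det_Ad_eq_one hG]

theorem equivariant_iff (θ : LieOneForm P G) :
    B.Equivariant θ ↔ ∀ (g : G) (u : P),
      (fun i => comp X θ (B.act u g) i ∘ₗ B.dR g u) = mulForms (adMatrix X g) (comp X θ u) := by
  refine forall_congr' fun g => forall_congr' fun u => ?_
  have key (i : Fin 3) (v : TangentSpace (𝓡 6) u) :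
      mulForms (adMatrix X g) (comp X θ u) i v = X.coord i (Ad g⁻¹ (θ u v)) := by
    rw [mulForms_apply]
    exact congrFun (LinearMap.toMatrix_mulVec_repr X X (Ad g⁻¹) (θ u v)) i
  constructor
  · intro h
    ext i v
    rw [key, ← LinearMap.comp_apply (Ad g⁻¹), ← h]
    rfl
  · intro h
    ext v : 1
    refine X.ext_elem fun i => ?_
    exact (LinearMap.congr_fun (congrFun h i) v).trans (key i v)

theorem smoothField_fundamental (A : GroupLieAlgebra (𝓡 3) G) :
    SmoothField Set.univ (B.fundamental A) :=
  (B.fundamental_smooth A).contMDiffOn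

theorem isSLag_toSU3 [ConnectedSpace G] (hG : Unimodular G)
    {t : LieOneForm P G × LieOneForm P G × (P → Matrix (Fin 3) (Fin 3) ℝ)} (ht : t ∈ B.triples X) :
    B.IsSLag (toSU3 X t).1 (toSU3 X t).2 ∧
      B.PositivelyOriented X (toSU3 X t).1 (toSU3 X t).2 := by
  obtain ⟨e, a, S⟩ := t
  obtain ⟨he, ha, hS⟩ : B.IsSolder X e ∧ B.IsConnection a ∧ B.IsEquivariantPosDef X S := ht
  have hc := isCoframe he ha
  have hadapt (u : P) := (hc u).exists_isAdapted (hS.posDef u) (finrank_tangentSpace u)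
    fun v h1 h2 => (hc u).eq_zero (he.nondegenerate u) (finrank_tangentSpace u) h1 h2
  have he' := (smoothLieOneForm_iff X e).1 he.smooth
  have ha' := (smoothLieOneForm_iff X a).1 ha.smooth
  refine ⟨⟨?_, ?_, fun u => ?_, fun g u => ?_, fun g u => ?_, fun u v hv => ?_, fun u v hv => ?_⟩,
    hadapt⟩
  · exact smoothForm_omegaOf he' ha' hS.smooth fun u => (hS.posDef u).det_pos
  · exact smoothForm_psiOf he' ha' hS.smooth
  · exact (hadapt u).imp fun _ h => h.1
  · change (omegaOf _ _ _).compLinearMap _ = omegaOf _ _ _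
    rw [omegaOf_compLinearMap, (equivariant_iff e).1 he.equivariant,
      (equivariant_iff a).1 ha.equivariant]
    exact (congrArg _ (hS.equivariant g u)).trans (omegaOf_mulForms _ _ (det_adMatrix hG g))
  · change (psiOf _ _ _).compLinearMap _ = psiOf _ _ _
    rw [psiOf_compLinearMap, (equivariant_iff e).1 he.equivariant,
      (equivariant_iff a).1 ha.equivariant]
    exact (congrArg _ (hS.equivariant g u)).trans (psiOf_mulForms _ _ (det_adMatrix hG g))
  · exact omegaOf_eq_zero fun i j => by rw [comp_apply, he.horizontal u _ (hv j), map_zero]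
  · exact psiOf_eq_zero fun i j => by rw [comp_apply, he.horizontal u _ (hv j), map_zero]

theorem injOn_toSU3 : Set.InjOn (toSU3 X) (B.triples X) := by
  rintro ⟨e, a, S⟩ ⟨he, ha, hS⟩ ⟨e', a', S'⟩ ⟨he', ha', hS'⟩ h
  have key (u : P) := (isCoframe he ha u).unique (isCoframe he' ha' u) (he.nondegenerate u)
    (hS.posDef u) (hS'.posDef u) (congrFun (congrArg Prod.fst h) u)
    (congrFun (congrArg Prod.snd h) u)
  obtain rfl : e = e' := comp_injective X fun u => (key u).1
  obtain rfl : a = a' := comp_injective X fun u => (key u).2.1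
  obtain rfl : S = S' := funext fun u => (key u).2.2
  rfl

theorem IsSLag.omega_fundamental {om : Form P 2} {ps : Form P 3} (h : B.IsSLag om ps) (u : P)
    (A A' : GroupLieAlgebra (𝓡 3) G) : om u ![B.fundamental A u, B.fundamental A' u] = 0 :=
  h.vanishes_omega u _ fun i => by fin_cases i <;> exact B.vertical_fundamental u _

theorem IsSLag.psi_fundamental {om : Form P 2} {ps : Form P 3} (h : B.IsSLag om ps) (u : P)
    (A : Fin 3 → GroupLieAlgebra (𝓡 3) G) : ps u (fun i => B.fundamental (A i) u) = 0 :=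
  h.vanishes_psi u _ fun _ => B.vertical_fundamental u _

theorem dR_fundamental_basis (g : G) (u : P) (j : Fin 3) :
    B.dR g u (B.fundamental (X j) u) =
      ∑ k, adMatrix X g k j • B.fundamental (X k) (B.act u g) := by
  rw [B.dR_fundamental]
  have h : Ad g⁻¹ (X j) = ∑ k, adMatrix X g k j • X k := by
    conv_lhs => rw [← X.sum_repr (Ad g⁻¹ (X j))]
    simp only [adMatrix, LinearMap.toMatrix_apply]
  rw [h, ← B.fundamentalLin_apply, map_sum]
  simp only [map_smul]
  rfl

theorem exists_triple [ConnectedSpace G] (hG : Unimodular G) {om : Form P 2} {ps : Form P 3}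
    (h : B.IsSLag om ps) (hpos : B.PositivelyOriented X om ps) :
    ∃ t ∈ B.triples X, toSU3 X t = (om, ps) := by
  choose L hL hL0 using hpos
  have hex (u : P) := exists_coframe (hL u) (fun i j => h.omega_fundamental u (X i) (X j))
    (h.psi_fundamental u X) (hL0 u)
  choose e a S hc he hS hom hps using hex
  have hX (i : Fin 3) : SmoothField Set.univ (B.fundamental (X i)) :=
    smoothField_fundamental (X i)
  have hequiv (g : G) (u : P) :
      (fun i => e (B.act u g) i ∘ₗ B.dR g u) = mulForms (adMatrix X g) (e u) ∧
      (fun i => a (B.act u g) i ∘ₗ B.dR g u) = mulForms (adMatrix X g) (a u) ∧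
      S (B.act u g) = adMatrix X g * S u * (adMatrix X g)ᵀ := by
    set R := adMatrix X g with hR
    have hRdet : R.det = 1 := det_adMatrix hG g
    have hRu : IsUnit R.det := by rw [hRdet]; exact isUnit_one
    have hQR := Matrix.nonsing_inv_mul R hRu
    have hRQ := Matrix.mul_nonsing_inv R hRu
    have hQdet : R⁻¹.det = 1 := by rw [Matrix.det_nonsing_inv, hRdet, Ring.inverse_one]
    have hQu : IsUnit R⁻¹ := (Matrix.isUnit_iff_isUnit_det _).2 (by rw [hQdet]; exact isUnit_one)
    -- The triple at u g, pulled back to u and corrected by R⁻¹, is again a coframe for X*, because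
    -- translation moves the fundamental fields by R. By invariance it gives the same forms at u, so
    -- uniqueness identifies it with the triple chosen at u.
    have hc' : IsCoframe (mulForms R⁻¹ fun i => e (B.act u g) i ∘ₗ B.dR g u)
        (mulForms R⁻¹ fun i => a (B.act u g) i ∘ₗ B.dR g u)
        (fun i => B.fundamental (X i) u) := by
      refine ⟨fun i j => ?_, fun i j => ?_⟩
      · rw [mulForms_apply, ← hQR, Matrix.mul_apply, Matrix.mulVec, dotProduct]
        refine Finset.sum_congr rfl fun k _ => ?_
        rw [LinearMap.comp_apply, dR_fundamental_basis, map_sum]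
        simp [(hc (B.act u g)).dual, Matrix.one_apply, ← hR]
      · rw [mulForms_apply, Matrix.mulVec, dotProduct]
        refine Finset.sum_eq_zero fun k _ => ?_
        rw [LinearMap.comp_apply, dR_fundamental_basis, map_sum]
        simp [(hc (B.act u g)).horizontal]
    have hS' : (R⁻¹ * S (B.act u g) * R⁻¹ᵀ).PosDef := by
      have := (hS (B.act u g)).mul_mul_conjTranspose_same
        (B := R⁻¹) (Matrix.vecMul_injective_of_isUnit hQu)
      rwa [Matrix.conjTranspose_eq_transpose_of_trivial] at this
    obtain ⟨h1, h2, h3⟩ := (hc u).unique hc' (he u) (hS u) hS'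
      (by rw [omegaOf_mulForms _ _ hQdet, ← omegaOf_compLinearMap, hom, hom, h.invariant_omega])
      (by rw [psiOf_mulForms _ _ hQdet, ← psiOf_compLinearMap, hps, hps, h.invariant_psi])
    refine ⟨?_, ?_, ?_⟩
    · rw [h1, mulForms_mulForms, hRQ, mulForms_one]
    · rw [h2, mulForms_mulForms, hRQ, mulForms_one]
    · rw [h3, ← Matrix.mul_assoc, ← Matrix.mul_assoc, hRQ, Matrix.one_mul, Matrix.mul_assoc,
        ← Matrix.transpose_mul, hRQ, Matrix.transpose_one, Matrix.mul_one]
  have hcomp := comp_ofComp (P := P) X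
  refine ⟨(ofComp X e, ofComp X a, S), ⟨⟨?_, ?_, ?_, ?_⟩, ⟨?_, ?_, ?_⟩, ?_, hS, ?_⟩, ?_⟩
  · rw [smoothLieOneForm_iff X, funext (hcomp e)]
    exact smoothOneForms_solder h.smooth_psi hX hc hps
  · rw [equivariant_iff (X := X)]
    simp only [hcomp]
    exact fun g u => (hequiv g u).1
  · intro u v hv
    obtain ⟨A, rfl⟩ := B.exists_fundamental_of_vertical hv
    -- Vertical vectors are fundamental, so it suffices to check the basis elements.
    have h0 : ofComp X e u ∘ₗ B.fundamentalLin u = 0 := by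
      refine X.ext fun j => X.ext_elem fun i => ?_
      refine (LinearMap.congr_fun (congrFun (hcomp e u) i) _).trans ?_
      rw [B.fundamentalLin_apply, (hc u).horizontal]
      simp
    exact LinearMap.congr_fun h0 A
  · intro u
    simp only [hcomp]
    exact he u
  · rw [smoothLieOneForm_iff X, funext (hcomp a)]
    exact smoothOneForms_connection h.smooth_omega h.smooth_psi hX hc hps he hS hom
  · rw [equivariant_iff (X := X)]
    simp only [hcomp]
    exact fun g u => (hequiv g u).2.1
  · intro A u
    have h0 : ofComp X a u ∘ₗ B.fundamentalLin u = LinearMap.id := by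
      refine X.ext fun j => X.ext_elem fun i => ?_
      refine (LinearMap.congr_fun (congrFun (hcomp a u) i) _).trans ?_
      rw [B.fundamentalLin_apply, (hc u).dual, LinearMap.id_apply, X.repr_self,
        Finsupp.single_apply, Matrix.one_apply]
      simp [eq_comm]
    exact LinearMap.congr_fun h0 A
  · exact contMDiff_posDef h.smooth_omega h.smooth_psi hX hc hps he hS hom
  · exact fun g u => (hequiv g u).2.2
  · refine Prod.ext (funext fun u => ?_) (funext fun u => ?_)
    · change omegaOf (comp X (ofComp X e) u) (comp X (ofComp X a) u) (S u) = _
      rw [hcomp, hcomp, hom]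
    · change psiOf (comp X (ofComp X e) u) (comp X (ofComp X a) u) (S u) = _
      rw [hcomp, hcomp, hps]

theorem bijOn_toSU3 [ConnectedSpace G] (hG : Unimodular G) :
    Set.BijOn (toSU3 X) (B.triples X)
      {p | p ∈ B.sLagStructures ∧ B.PositivelyOriented X p.1 p.2} :=
  ⟨fun _ ht => isSLag_toSU3 hG ht, injOn_toSU3, fun _ hp => exists_triple hG hp.1 hp.2⟩

theorem isAdapted_units_smul {V : Type*} [AddCommGroup V] [Module ℝ V] {om : V [⋀^Fin 2]→ₗ[ℝ] ℝ}
    {ps : V [⋀^Fin 3]→ₗ[ℝ] ℝ} {L : V ≃ₗ[ℝ] (Fin 3 → ℂ)} (hL : IsAdapted om ps L) (s : ℤˣ) :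
    ∃ L', IsAdapted (((s : ℤ) : ℝ) • om) ps L' := by
  rcases Int.units_eq_one_or s with rfl | rfl
  · exact ⟨L, by simpa using hL⟩
  · refine ⟨L.trans negConj, ?_⟩
    have h1 : (((-1 : ℤˣ) : ℤ) : ℝ) • om = -om := by ext v; simp
    rw [h1]
    exact hL.negConj

theorem isSLag_signTwist [ConnectedSpace G] {s : P → ℤˣ} (hs : IsLocallyConstant s)
    {p : Form P 2 × Form P 3} (hp : B.IsSLag p.1 p.2) :
    B.IsSLag (signTwist s p).1 (signTwist s p).2 := by
  -- A locally constant function is constant on the orbit of u, a continuous image of the connected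
  -- group G.
  have hinv (g : G) (u : P) : s (B.act u g) = s u := by
    have h := (hs.comp_continuous (B.contMDiff_act_right u).continuous).apply_eq_of_preconnectedSpace
      g 1
    simpa [B.act_one] using h
  refine ⟨fun U hU V hV u hu => ?_, hp.smooth_psi, fun u => ?_, fun g u => ?_, hp.invariant_psi,
    fun u v hv => ?_, hp.vanishes_psi⟩
  · refine ((contMDiffWithinAt_const (c := ((s u : ℤ) : ℝ))).mul
      (hp.smooth_omega U hU V hV u hu)).congr_of_eventuallyEq ?_ rfl
    filter_upwards [nhdsWithin_le_nhds (hs.eventually_eq u)] with v hv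
    simp only [signTwist, AlternatingMap.smul_apply, smul_eq_mul, hv, Pi.mul_apply]
  · obtain ⟨L, hL⟩ := hp.adapted u
    exact isAdapted_units_smul hL (s u)
  · ext v
    have := DFunLike.congr_fun (hp.invariant_omega g u) v
    simp only [signTwist, hinv]
    exact congrArg (((s u : ℤ) : ℝ) * ·) this
  · simp only [signTwist, AlternatingMap.smul_apply, hp.vanishes_omega u v hv, smul_zero]

theorem signTwist_signTwist (s : P → ℤˣ) (p : Form P 2 × Form P 3) :
    signTwist s (signTwist s p) = p := by
  refine Prod.ext (funext fun u => ?_) rfl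
  simp only [signTwist, smul_smul]
  rcases Int.units_eq_one_or (s u) with h | h <;> simp [h]

theorem exists_sign [ConnectedSpace G] (X : Module.Basis (Fin 3) ℝ (GroupLieAlgebra (𝓡 3) G))
    {p : Form P 2 × Form P 3} (hp : B.IsSLag p.1 p.2) :
    ∃ s : P → ℤˣ, IsLocallyConstant s ∧
      B.PositivelyOriented X (signTwist s p).1 (signTwist s p).2 := by
  choose L₀ hL₀ using hp.adapted
  have hex (u : P) := exists_sign_isAdapted (hL₀ u) (B.fundamental_linearIndependent X u)
    (fun i j => hp.omega_fundamental u (X i) (X j)) (hp.psi_fundamental u X)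
  choose s L hL hL0 using hex
  refine ⟨s, ?_, fun u => ⟨L u, hL u, hL0 u⟩⟩
  have hcof (u : P) := exists_coframe (hL u)
    (fun i j => by
      rw [AlternatingMap.smul_apply, hp.omega_fundamental u (X i) (X j), smul_zero])
    (hp.psi_fundamental u X) (hL0 u)
  choose e a S hc he hS hom hps using hcof
  have hX (i : Fin 3) : SmoothField Set.univ (B.fundamental (X i)) :=
    smoothField_fundamental (X i)
  -- The sign twist leaves ψ unchanged, so e is smooth before anything is known about the regularity
  -- of s.
  have he' := smoothOneForms_solder hp.smooth_psi hX hc hps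
  rw [IsLocallyConstant.iff_eventually_eq]
  intro u₀
  obtain ⟨U, W, hU, hu, hW, hWe⟩ := exists_local_dual_frame he' u₀ (he u₀)
  have hsm := hp.smooth_omega.apply_two hU ((hX 0).mono (Set.subset_univ _)) (hW 0)
  -- This value is a diagonal entry of N, so s is the sign of ω(X₀*, W₀), a continuous nonvanishing
  -- function near u₀.
  have hsign : ∀ u ∈ U, 0 < ((s u : ℤ) : ℝ) * p.1 u ![B.fundamental (X 0) u, W 0 u] := by
    intro u hu
    have h1 := (hc u).omegaOf_dual (S := S u) (hWe u hu) 0 0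
    rw [hom, AlternatingMap.smul_apply, smul_eq_mul] at h1
    rw [h1]
    exact (coeffMatrix_posDef (hS u)).diag_pos
  have hcont := (hsm.continuousOn.continuousAt (hU.mem_nhds hu)).const_mul ((s u₀ : ℤ) : ℝ)
  filter_upwards [hU.mem_nhds hu, hcont.eventually_const_lt (hsign u₀ hu)] with u huU hlt
  have h1 := hsign u huU
  rcases Int.units_eq_one_or (s u) with h | h <;> rcases Int.units_eq_one_or (s u₀) with h' | h' <;>
    rw [h] at h1 ⊢ <;> rw [h'] at hlt ⊢ <;> exfalso <;> norm_num at h1 hlt <;> linarith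

theorem bijOn_signTwist [ConnectedSpace G] (hG : Unimodular G) :
    Set.BijOn (fun q => signTwist q.1 (toSU3 X q.2))
      ({s : P → ℤˣ | IsLocallyConstant s} ×ˢ B.triples X) B.sLagStructures := by
  refine ⟨fun q hq => isSLag_signTwist hq.1 (isSLag_toSU3 hG hq.2).1, ?_, fun p hp => ?_⟩
  · rintro ⟨s, e, a, S⟩ ⟨hs, ht⟩ ⟨s', e', a', S'⟩ ⟨hs', ht'⟩ h
    obtain ⟨he, ha, hS⟩ := ht
    obtain ⟨he', ha', hS'⟩ := ht'
    obtain rfl : s = s' := funext fun u =>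
      (isCoframe he ha u).sign_eq (isCoframe he' ha' u) (he.nondegenerate u) (hS.posDef u)
        (hS'.posDef u) (congrFun (congrArg Prod.fst h) u) (congrFun (congrArg Prod.snd h) u)
    have h2 := congrArg (signTwist s) h
    simp only [signTwist_signTwist] at h2
    exact Prod.ext rfl (injOn_toSU3 ⟨he, ha, hS⟩ ⟨he', ha', hS'⟩ h2)
  · obtain ⟨s, hs, hpos⟩ := exists_sign X hp
    obtain ⟨t, ht, htp⟩ := exists_triple hG (isSLag_signTwist hs hp) hpos
    refine ⟨(s, t), ⟨hs, ht⟩, ?_⟩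
    change signTwist s (toSU3 X t) = p
    rw [htp]
    exact signTwist_signTwist s p

end PrincipalBundle

end SLag

theorem theorem3p1 {G P M : Type*}
    [TopologicalSpace G] [ChartedSpace (EuclideanSpace ℝ (Fin 3)) G] [Group G]
    [LieGroup (𝓡 3) ∞ G] [ConnectedSpace G]
    [TopologicalSpace P] [ChartedSpace (EuclideanSpace ℝ (Fin 6)) P] [IsManifold (𝓡 6) ∞ P]
    [TopologicalSpace M] [ChartedSpace (EuclideanSpace ℝ (Fin 3)) M] [IsManifold (𝓡 3) ∞ M]
    (B : SLag.PrincipalBundle G P M) (hG : SLag.Unimodular G)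
    (X : Module.Basis (Fin 3) ℝ (GroupLieAlgebra (𝓡 3) G)) :
    Set.BijOn (SLag.toSU3 X) (B.triples X)
      {p | p ∈ B.sLagStructures ∧ B.PositivelyOriented X p.1 p.2} ∧
    Set.BijOn (fun q => SLag.signTwist q.1 (SLag.toSU3 X q.2))
      ({s : P → ℤˣ | IsLocallyConstant s} ×ˢ B.triples X)
      B.sLagStructures :=
  ⟨SLag.PrincipalBundle.bijOn_toSU3 hG, SLag.PrincipalBundle.bijOn_signTwist hG⟩

end
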